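/- Let $C$ be a smooth complex projective curve of genus $g\ge 4$, i.e. a compact connected Riemann surface with $h^0(C,K_C)=g\geq 4$, and let $\operatorname{Aut}(C)$ be its group of biholomorphic automorphisms. For $x\in C$ let $H^0(C,K_C(2x))$ be the space of $1$-forms that are holomorphic on $C\setminus\{x\}$ and have at most a double pole at $x$. Restriction is an isomorphism $H^1(C,\mathbb C)\cong H^1(C\setminus\{x\},\mathbb C)$; let $j_x(\varphi)\in H^1(C,\mathbb C)$ be the class that corresponds to the class of $\varphi\in H^0(C,K_C(2x))$ on $C\setminus\{x\}$. The subspace $j_x^{-1}(H^{0,1}(C))$ is a line, and for a chart $z$ centred at $x$ it contains a unique element of the form $\varphi=\bigl(\frac1{z^2}+h(z)\bigr)dz$ with $h$ holomorphic. Let $$\eta_x:T_xC\to H^0(C,K_C(2x)),\qquad \eta_x\Bigl(\lambda\tfrac{\partial}{\partial z}(x)\Bigr)=\lambda\varphi ,$$ which does not depend on the chart. Thus $\eta:x\mapsto\eta_x$ is a section of the vector bundle $E$ on $C$ with fibres $E_x=T_x^*C\otimes H^0(C,K_C(2x))$. Let $S=C\times C$ with diagonal $\Delta$, and let $\hat\eta\in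 H^0(S,K_S(2\Delta))$ be the section corresponding to $\eta$, that is, the one with $\hat\eta\bigl((u,0),(0,v)\bigr)=\eta_x(u)(v)$ for all $x\neq y$, $u\in T_xC$, $v\in T_yC$. The group $\operatorname{Aut}(C)$ acts on sections $\alpha$ of $E$ by $$(\sigma\cdot\alpha)_{\sigma(y)}=\bigl((d\sigma^{-1})^*\otimes(\sigma^{-1})^*\bigr)(\alpha_y),$$ that is, $(\sigma\cdot\alpha)_x(u)=(\sigma^{-1})^*\bigl(\alpha_{\sigma^{-1}(x)}(d\sigma^{-1}(u))\bigr)$ for $u\in T_xC$, and on $H^0(S,K_S(2\Delta))$ through its diagonal action on $S$, by $\sigma\cdot\beta=(\sigma^{-1}\times\sigma^{-1})^*\beta$. Then $\eta$ and $\hat\eta$ are invariant under these actions: for every $\sigma\in\operatorname{Aut}(C)$, $$\sigma\cdot\eta=\eta\qquad\text{and}\qquad \sigma\cdot\hat\eta=\hat\eta .$$ -/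

import Mathlib

open scoped Manifold ContDiff Topology

noncomputable section

namespace RiemannSurface

section OneForms

variable (C : Type*) [TopologicalSpace C] [ChartedSpace ℂ C]

/-- The holomorphic charts `z : U → ℂ` of the Riemann surface `C`. -/
abbrev Charts : Set (OpenPartialHomeomorph C ℂ) := IsManifold.maximalAtlas 𝓘(ℂ) ω C

/-- The group `Aut(C)` of biholomorphic maps `C → C`. -/
abbrev Aut := C ≃ₘ^ω⟮𝓘(ℂ), 𝓘(ℂ)⟯ C

/-- The complex tangent line `T_x C`. -/
abbrev T {C : Type*} [TopologicalSpace C] [ChartedSpace ℂ C] (x : C) := TangentSpace 𝓘(ℂ) x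

/-- Forms of type `(1,0)`, without regularity assumption: sections of `T^*C`. -/
abbrev Form10 := (y : C) → (T y →L[ℂ] ℂ)

variable {C}

/-- The coordinate vector `∂/∂z` of the chart `e = z`, at the point with coordinate `z`. -/
def ddz (e : OpenPartialHomeomorph C ℂ) (z : ℂ) : T (e.symm z) :=
  mfderiv 𝓘(ℂ) 𝓘(ℂ) e.symm z (1 : ℂ)

/-- The coefficient `a` of the form `α = a(z) dz` in the chart `e = z`. -/
def coeff (e : OpenPartialHomeomorph C ℂ) (α : Form10 C) (z : ℂ) : ℂ :=
  α (e.symm z) (ddz e z)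

/-- The `(1,0)`-form `α` is holomorphic on `U`. -/
def IsHolOn (α : Form10 C) (U : Set C) : Prop :=
  ∀ e ∈ Charts C, DifferentiableOn ℂ (coeff e α) (e.target ∩ e.symm ⁻¹' U)

/-- `α` has at `x` at most a double pole: `(z - z(x))² a(z)` extends holomorphically over `z(x)`
in every chart `z` around `x`. -/
def HasDoublePoleAt (α : Form10 C) (x : C) : Prop :=
  ∀ e ∈ Charts C, x ∈ e.source → ∃ h : ℂ → ℂ, AnalyticAt ℂ h (e x) ∧
    ∀ᶠ z in 𝓝[≠] (e x), (z - e x) ^ 2 * coeff e α z = h z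

variable (C) in
/-- `H⁰(C, K_C)`. -/
def H0K : Submodule ℂ (Form10 C) where
  carrier := {α | IsHolOn α Set.univ}
  zero_mem' := fun _ _ => differentiableOn_const (0 : ℂ)
  add_mem' := fun ha hb e he => (ha e he).add (hb e he)
  smul_mem' := fun c _ ha e he => (ha e he).const_smul c

variable (C) in
/-- The genus `h⁰(C, K_C)`. -/
def genus : ℕ := Module.finrank ℂ (H0K C)

/-- `H⁰(C, K_C(2x))`: the forms holomorphic on `C ∖ {x}` with at most a double pole at `x`. Such a
form has no value at `x`; it is represented by the section of `T^*C` that takes the value `0` there,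
so that equality in this space is equality on `C ∖ {x}`. -/
def H0K2 (x : C) : Submodule ℂ (Form10 C) where
  carrier := {α | α x = 0 ∧ IsHolOn α {x}ᶜ ∧ HasDoublePoleAt α x}
  zero_mem' := ⟨rfl, fun _ _ => differentiableOn_const (0 : ℂ),
    fun _ _ _ => ⟨fun _ => 0, analyticAt_const, by
      filter_upwards with z
      simp [coeff]⟩⟩
  add_mem' := by
    rintro a b ⟨ha0, ha1, ha2⟩ ⟨hb0, hb1, hb2⟩
    refine ⟨by simp [ha0, hb0], fun e he => (ha1 e he).add (hb1 e he), fun e he hx => ?_⟩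
    obtain ⟨h, hh, hE⟩ := ha2 e he hx
    obtain ⟨k, hk, hF⟩ := hb2 e he hx
    refine ⟨h + k, hh.add hk, ?_⟩
    filter_upwards [hE, hF] with z h1 h2
    rw [Pi.add_apply, ← h1, ← h2, ← mul_add]
    rfl
  smul_mem' := by
    rintro c a ⟨ha0, ha1, ha2⟩
    refine ⟨by simp [ha0], fun e he => (ha1 e he).const_smul c, fun e he hx => ?_⟩
    obtain ⟨h, hh, hE⟩ := ha2 e he hx
    refine ⟨fun z => c * h z, analyticAt_const.mul hh, ?_⟩
    filter_upwards [hE] with z h1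
    rw [← h1, mul_left_comm]
    rfl

end OneForms

/-! ### De Rham cohomology with complex coefficients -/

section DeRham

/-- The real tangent plane `T_x C`; it has the same elements as `T x`. -/
abbrev TR {C : Type*} [TopologicalSpace C] [ChartedSpace ℂ C] (x : C) := TangentSpace 𝓘(ℝ, ℂ) x

/-- Complex valued 1-forms, without regularity assumption. -/
abbrev Form1 (C : Type*) [TopologicalSpace C] [ChartedSpace ℂ C] := (y : C) → (TR y →L[ℝ] ℂ)

variable {C : Type*} [TopologicalSpace C] [ChartedSpace ℂ C]

instance instAddCommGroupForm1 : AddCommGroup (Form1 C) := Pi.addCommGroup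

/-- The expression `(e⁻¹)^* α` of a 1-form `α` in a chart `e`. -/
def inChart (e : OpenPartialHomeomorph C ℂ) (α : Form1 C) (z : ℂ) : ℂ →L[ℝ] ℂ :=
  (α (e.symm z)).comp (mfderiv 𝓘(ℝ, ℂ) 𝓘(ℝ, ℂ) e.symm z)

theorem inChart_contDiffAt_aux {e : OpenPartialHomeomorph C ℂ} {α : Form1 C}
    {U : TopologicalSpace.Opens C}
    (h : ContDiffOn ℝ ∞ (inChart e α) (e.target ∩ e.symm ⁻¹' U)) {z : ℂ}
    (hz : z ∈ e.target ∩ e.symm ⁻¹' U) : DifferentiableAt ℝ (inChart e α) z :=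
  (h.differentiableOn (by simp)).differentiableAt
    ((e.isOpen_inter_preimage_symm U.isOpen).mem_nhds hz)

/-- The forms that are smooth and closed on `U` (nothing is required off `U`). -/
def closedForms (U : TopologicalSpace.Opens C) : Submodule ℂ (Form1 C) where
  carrier := {α | ∀ e ∈ Charts C,
    ContDiffOn ℝ ∞ (inChart e α) (e.target ∩ e.symm ⁻¹' U) ∧
    ∀ z ∈ e.target ∩ e.symm ⁻¹' U, ∀ v w : ℂ,
      fderiv ℝ (inChart e α) z v w = fderiv ℝ (inChart e α) z w v}
  zero_mem' := fun e _ => by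
    have : inChart e (0 : Form1 C) = fun _ => 0 := by
      funext z
      exact ContinuousLinearMap.zero_comp _
    rw [this]
    exact ⟨contDiffOn_const, by simp⟩
  add_mem' := by
    intro a b ha hb e he
    obtain ⟨ha1, ha2⟩ := ha e he
    obtain ⟨hb1, hb2⟩ := hb e he
    have : inChart e (a + b) = inChart e a + inChart e b := by
      funext z
      exact ContinuousLinearMap.add_comp _ _ _
    rw [this]
    refine ⟨ha1.add hb1, fun z hz v w => ?_⟩
    rw [fderiv_add (inChart_contDiffAt_aux ha1 hz) (inChart_contDiffAt_aux hb1 hz)]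
    simp [ha2 z hz v w, hb2 z hz v w]
  smul_mem' := by
    intro c a ha e he
    obtain ⟨ha1, ha2⟩ := ha e he
    have : inChart e (c • a) = c • inChart e a := by
      funext z
      exact ContinuousLinearMap.smul_comp _ _ _
    rw [this]
    refine ⟨ha1.const_smul c, fun z hz v w => ?_⟩
    rw [fderiv_const_smul (inChart_contDiffAt_aux ha1 hz)]
    simp [ha2 z hz v w]

/-- The forms that are exact on `U`: there `α = df` for a smooth `f : U → ℂ`. -/
def exactForms (U : TopologicalSpace.Opens C) : Submodule ℂ (Form1 C) where
  carrier := {α | ∃ f : C → ℂ, ContMDiffOn 𝓘(ℝ, ℂ) 𝓘(ℝ, ℂ) ∞ f U ∧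
    ∀ y ∈ U, α y = mfderiv 𝓘(ℝ, ℂ) 𝓘(ℝ, ℂ) f y}
  zero_mem' := ⟨fun _ => 0, contMDiffOn_const, fun y _ => by rw [mfderiv_const]; rfl⟩
  add_mem' := by
    rintro a b ⟨f, hf, hfa⟩ ⟨g, hg, hgb⟩
    refine ⟨f + g, hf.add hg, fun y hy => ?_⟩
    have h1 := (hf.contMDiffAt (U.isOpen.mem_nhds hy)).mdifferentiableAt (by simp)
    have h2 := (hg.contMDiffAt (U.isOpen.mem_nhds hy)).mdifferentiableAt (by simp)
    rw [mfderiv_add h1 h2, Pi.add_apply, hfa y hy, hgb y hy]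
    rfl
  smul_mem' := by
    rintro c a ⟨f, hf, hfa⟩
    let L : ℂ →L[ℝ] ℂ := c • ContinuousLinearMap.id ℝ ℂ
    refine ⟨L ∘ f, L.contMDiff.comp_contMDiffOn hf, fun y hy => ?_⟩
    have h1 := (hf.contMDiffAt (U.isOpen.mem_nhds hy)).mdifferentiableAt (by simp)
    rw [(L.hasMFDerivAt.comp y h1.hasMFDerivAt).mfderiv, Pi.smul_apply, hfa y hy]
    rfl

/-- `H¹(U, ℂ)`. -/
abbrev H1 (U : TopologicalSpace.Opens C) :=
  closedForms U ⧸ (exactForms U).comap (closedForms U).subtype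

theorem closedForms_mono {U V : TopologicalSpace.Opens C} (h : U ≤ V) :
    closedForms V ≤ closedForms U := fun _ ha e he =>
  have hs : e.target ∩ e.symm ⁻¹' U ⊆ e.target ∩ e.symm ⁻¹' V := fun _ hz => ⟨hz.1, h hz.2⟩
  ⟨(ha e he).1.mono hs, fun z hz => (ha e he).2 z (hs hz)⟩

theorem exactForms_mono {U V : TopologicalSpace.Opens C} (h : U ≤ V) :
    exactForms V ≤ exactForms U := by
  rintro a ⟨f, hf, hfa⟩
  exact ⟨f, hf.mono h, fun y hy => hfa y (h hy)⟩

/-- The restriction map `H¹(V, ℂ) → H¹(U, ℂ)` for `U ⊆ V`. -/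
def restrict {U V : TopologicalSpace.Opens C} (h : U ≤ V) : H1 V →ₗ[ℂ] H1 U :=
  Submodule.mapQ _ _ (Submodule.inclusion (closedForms_mono h))
    (fun a ha => exactForms_mono h ha)

variable (C) in
/-- The forms of type `(0,1)`: those that are antilinear on each tangent space. -/
def forms01 : Submodule ℂ (Form1 C) where
  carrier := {α | ∀ (y : C) (v : ℂ), α y (Complex.I * v : ℂ) = -Complex.I * α y v}
  zero_mem' := fun _ _ => (mul_zero (-Complex.I)).symm
  add_mem' := fun {α β} ha hb y v => by
    have h : α y (Complex.I * v : ℂ) + β y (Complex.I * v : ℂ)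
        = -Complex.I * (α y v + β y v) := by
      rw [ha y v, hb y v, mul_add]
    exact h
  smul_mem' := fun c α ha y v => by
    have h : c * (show ℂ from α y (Complex.I * v : ℂ)) = -Complex.I * (c * (show ℂ from α y v)) := by
      rw [mul_left_comm]
      exact congrArg (c * ·) (ha y v)
    exact h

variable (C) in
/-- `H^{0,1}(C) ⊆ H¹(C, ℂ)`: the classes of the closed forms of type `(0,1)`. -/
def H01 : Submodule ℂ (H1 (⊤ : TopologicalSpace.Opens C)) :=
  ((forms01 C).comap (closedForms ⊤).subtype).map (Submodule.mkQ _)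

end DeRham

/-! ### The form `η_x` -/

section Eta

variable {C : Type*} [TopologicalSpace C] [ChartedSpace ℂ C]

/-- A complex linear map `ℂ → ℂ` regarded as a real linear map. -/
def realify (L : ℂ →L[ℂ] ℂ) : ℂ →L[ℝ] ℂ := L.restrictScalars ℝ

/-- A `(1,0)`-form regarded as a complex valued 1-form (recall that `T y` and `TR y` are `ℂ`). -/
def toForm1 : Form10 C →ₗ[ℂ] Form1 C where
  toFun α y := realify (α y)
  map_add' _ _ := rfl
  map_smul' _ _ := rfl

theorem mdifferentiableAt_symm {e : OpenPartialHomeomorph C ℂ} [IsManifold 𝓘(ℂ) ω C]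
    (he : e ∈ Charts C) {z : ℂ} (hz : z ∈ e.target) :
    MDifferentiableAt 𝓘(ℂ) 𝓘(ℂ) e.symm z :=
  ((contMDiffOn_symm_of_mem_maximalAtlas he).contMDiffAt
    (e.open_target.mem_nhds hz)).mdifferentiableAt (by simp)

theorem mfderiv_restrictScalars {f : ℂ → C} {z : ℂ} (h : MDifferentiableAt 𝓘(ℂ) 𝓘(ℂ) f z) :
    mfderiv 𝓘(ℝ, ℂ) 𝓘(ℝ, ℂ) f z
      = realify (mfderiv 𝓘(ℂ) 𝓘(ℂ) f z) := by
  obtain ⟨h1, h2⟩ := h.hasMFDerivAt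
  have h3 : HasMFDerivAt 𝓘(ℝ, ℂ) 𝓘(ℝ, ℂ) f z
      (realify (mfderiv 𝓘(ℂ) 𝓘(ℂ) f z)) :=
    ⟨h1, HasFDerivWithinAt.restrictScalars ℝ h2⟩
  exact h3.mfderiv

theorem inChart_toForm1 [IsManifold 𝓘(ℂ) ω C] {e : OpenPartialHomeomorph C ℂ}
    (he : e ∈ Charts C) (α : Form10 C) {z : ℂ} (hz : z ∈ e.target) :
    inChart e (toForm1 α) z = ContinuousLinearMap.mul ℝ ℂ (coeff e α z) := by
  have key : ∀ A B : ℂ →L[ℂ] ℂ,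
      (realify A).comp (realify B) = ContinuousLinearMap.mul ℝ ℂ (A (B 1)) := fun A B => by
    ext v
    change A (B v) = A (B 1) * v
    conv_lhs => rw [← mul_one v, ← smul_eq_mul, map_smul, map_smul, smul_eq_mul, mul_comm]
  unfold inChart
  rw [mfderiv_restrictScalars (mdifferentiableAt_symm he hz)]
  exact key (α (e.symm z)) (mfderiv 𝓘(ℂ) 𝓘(ℂ) e.symm z)

theorem toForm1_mem_closedForms [IsManifold 𝓘(ℂ) ω C] {U : TopologicalSpace.Opens C}
    {α : Form10 C} (h : IsHolOn α U) : toForm1 α ∈ closedForms U := by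
  intro e he
  have ho : IsOpen (e.target ∩ e.symm ⁻¹' U) := e.isOpen_inter_preimage_symm U.isOpen
  have hc : ContDiffOn ℝ ∞ (coeff e α) (e.target ∩ e.symm ⁻¹' U) :=
    ((h e he).contDiffOn ho).restrict_scalars ℝ
  have heq : Set.EqOn (inChart e (toForm1 α)) (fun z => ContinuousLinearMap.mul ℝ ℂ (coeff e α z))
      (e.target ∩ e.symm ⁻¹' U) := fun z hz => inChart_toForm1 he α hz.1
  refine ⟨ContDiffOn.congr ((ContinuousLinearMap.mul ℝ ℂ).contDiff.comp_contDiffOn hc) heq,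
    fun z hz v w => ?_⟩
  have hd := ((h e he).differentiableAt (ho.mem_nhds hz)).hasFDerivAt.restrictScalars ℝ
  have hd2 := ((ContinuousLinearMap.mul ℝ ℂ).hasFDerivAt.comp z hd).congr_of_eventuallyEq
    (heq.eventuallyEq_of_mem (ho.mem_nhds hz))
  rw [hd2.fderiv]
  have key : ∀ (L : ℂ →L[ℂ] ℂ) (v w : ℂ), L v * w = L w * v := fun L v w => by
    have hL : ∀ u, L u = u * L 1 := fun u => by
      conv_lhs => rw [← mul_one u, ← smul_eq_mul, map_smul, smul_eq_mul]
    rw [hL v, hL w]; ring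
  exact key _ v w

variable [T2Space C]

/-- The open set `C ∖ {x}`. -/
def punctured (x : C) : TopologicalSpace.Opens C := ⟨{x}ᶜ, isOpen_compl_singleton⟩

variable [IsManifold 𝓘(ℂ) ω C]

/-- The map `H⁰(C, K_C(2x)) → H¹(C ∖ {x}, ℂ)`, `φ ↦ [φ]`. -/
def classOff (x : C) : H0K2 x →ₗ[ℂ] H1 (punctured x) :=
  (Submodule.mkQ _).comp
    ((toForm1.comp (H0K2 x).subtype).codRestrict (closedForms (punctured x))
      fun φ => toForm1_mem_closedForms φ.2.2.1)

/-- The line `j_x⁻¹(H^{0,1}(C))` in `H⁰(C, K_C(2x))`. Here `j_x φ ∈ H¹(C, ℂ)` is the class that the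
isomorphism `H¹(C, ℂ) → H¹(C ∖ {x}, ℂ)` given by restriction carries to `[φ]`. -/
def etaLine (x : C) : Submodule ℂ (H0K2 x) :=
  ((H01 C).map (restrict (le_top : punctured x ≤ ⊤))).comap (classOff x)

/-- In the chart `z` at `x`, `φ = (1/(z - z(x))² + h(z)) dz` with `h` holomorphic. -/
def HasPrincipalPart (x : C) (φ : Form10 C) : Prop :=
  ∃ h : ℂ → ℂ, DifferentiableOn ℂ h (chartAt ℂ x).target ∧
    ∀ z ∈ (chartAt ℂ x).target, z ≠ chartAt ℂ x x →
      coeff (chartAt ℂ x) φ z = 1 / (z - chartAt ℂ x x) ^ 2 + h z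

open scoped Classical in
/-- The unique element `φ = (1/(z - z(x))² + h(z)) dz` of the line `j_x⁻¹(H^{0,1}(C))`, for the
chart `z` at `x`. -/
def phi (x : C) : H0K2 x :=
  if h : ∃ φ ∈ etaLine x, HasPrincipalPart x (φ : Form10 C) then h.choose else 0

/-- The fibre `E_x = T_x^*C ⊗ H⁰(C, K_C(2x)) = Hom(T_x C, H⁰(C, K_C(2x)))` of `E`. -/
abbrev E {C : Type*} [TopologicalSpace C] [ChartedSpace ℂ C] (x : C) := T x →ₗ[ℂ] H0K2 x

/-- The section `η` of `E`: `η_x(λ ∂/∂z) = λ φ`, where `λ = dz(u)` for `u = λ ∂/∂z`. -/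
def eta (x : C) : E x :=
  LinearMap.toSpanSingleton ℂ (H0K2 x) (phi x) ∘ₗ
    (mfderiv 𝓘(ℂ) 𝓘(ℂ) (chartAt ℂ x) x : T x →L[ℂ] ℂ).toLinearMap

end Eta

/-! ### Transport by automorphisms -/

section Action

variable {C : Type*} [TopologicalSpace C] [ChartedSpace ℂ C]

/-- The pull-back `τ^* α`. -/
def pullback (τ : Aut C) : Form10 C →ₗ[ℂ] Form10 C where
  toFun α y := (α (τ y)).comp (mfderiv 𝓘(ℂ) 𝓘(ℂ) τ y)
  map_add' _ _ := by ext; rfl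
  map_smul' _ _ := by ext; rfl

/-- The chart `e ∘ τ⁻¹`. -/
def moveChart (τ : Aut C) (e : OpenPartialHomeomorph C ℂ) : OpenPartialHomeomorph C ℂ :=
  τ.symm.toHomeomorph.transOpenPartialHomeomorph e

theorem moveChart_mem [IsManifold 𝓘(ℂ) ω C] (τ : Aut C) {e : OpenPartialHomeomorph C ℂ}
    (he : e ∈ Charts C) : moveChart τ e ∈ Charts C := by
  have h1 : ContMDiffOn 𝓘(ℂ) 𝓘(ℂ) ω (moveChart τ e) (moveChart τ e).source :=
    (contMDiffOn_of_mem_maximalAtlas he).comp τ.symm.contMDiff.contMDiffOn fun _ h => h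
  have h2 : ContMDiffOn 𝓘(ℂ) 𝓘(ℂ) ω (moveChart τ e).symm (moveChart τ e).target :=
    τ.contMDiff.comp_contMDiffOn (contMDiffOn_symm_of_mem_maximalAtlas he)
  exact (moveChart τ e).mem_maximalAtlas_of_contMDiffOn h1 h2

theorem ddz_moveChart [IsManifold 𝓘(ℂ) ω C] (τ : Aut C) {e : OpenPartialHomeomorph C ℂ}
    (he : e ∈ Charts C) {z : ℂ} (hz : z ∈ e.target) :
    ddz (moveChart τ e) z = mfderiv 𝓘(ℂ) 𝓘(ℂ) τ (e.symm z) (ddz e z) := by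
  have h1 : MDifferentiableAt 𝓘(ℂ) 𝓘(ℂ) τ (e.symm z) :=
    τ.contMDiff.mdifferentiable (by simp) _
  have h2 := mfderiv_comp z h1 (mdifferentiableAt_symm he hz)
  exact congrArg (fun L : ℂ →L[ℂ] ℂ => L 1) h2

theorem coeff_pullback [IsManifold 𝓘(ℂ) ω C] (τ : Aut C) (α : Form10 C)
    {e : OpenPartialHomeomorph C ℂ} (he : e ∈ Charts C) {z : ℂ} (hz : z ∈ e.target) :
    coeff e (pullback τ α) z = coeff (moveChart τ e) α z := by
  unfold coeff
  rw [ddz_moveChart τ he hz]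
  rfl

theorem pullback_mem [IsManifold 𝓘(ℂ) ω C] (τ : Aut C) (x : C) {α : Form10 C}
    (hα : α ∈ H0K2 (τ x)) : pullback τ α ∈ H0K2 x := by
  obtain ⟨h0, h1, h2⟩ := hα
  refine ⟨?_, fun e he => ?_, fun e he hx => ?_⟩
  · change (α (τ x)).comp _ = 0
    rw [h0]
    exact ContinuousLinearMap.zero_comp _
  · refine ((h1 _ (moveChart_mem τ he)).mono ?_).congr fun z hz => coeff_pullback τ α he hz.1
    exact fun z hz => ⟨hz.1, fun h => hz.2 (τ.injective h)⟩
  · have hs : τ x ∈ (moveChart τ e).source := by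
      change τ.symm (τ x) ∈ e.source
      rwa [τ.symm_apply_apply]
    have hv : moveChart τ e (τ x) = e x := by
      change e (τ.symm (τ x)) = e x
      rw [τ.symm_apply_apply]
    obtain ⟨h, hh, hE⟩ := h2 _ (moveChart_mem τ he) hs
    rw [hv] at hh hE
    refine ⟨h, hh, ?_⟩
    filter_upwards [hE, mem_nhdsWithin_of_mem_nhds (e.open_target.mem_nhds (e.map_source hx))]
      with z hz hz2
    rw [coeff_pullback τ α he hz2, hz]

/-- `τ^* : H⁰(C, K_C(2τ(x))) → H⁰(C, K_C(2x))`. -/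
def pullbackV [IsManifold 𝓘(ℂ) ω C] (τ : Aut C) (x : C) : H0K2 (τ x) →ₗ[ℂ] H0K2 x :=
  (pullback τ).restrict fun _ => pullback_mem τ x

/-- The action of `Aut(C)` on sections of `E`, `(σ · α)_{σ(y)} = ((dσ⁻¹)^* ⊗ (σ⁻¹)^*)(α_y)`; that
is, `(σ · α)_x(u) = (σ⁻¹)^* (α_{σ⁻¹(x)}(dσ⁻¹(u)))` for `u ∈ T_x C`. -/
def actE [IsManifold 𝓘(ℂ) ω C] (σ : Aut C) (α : (x : C) → E x) : (x : C) → E x := fun x =>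
  pullbackV σ.symm x ∘ₗ α (σ.symm x) ∘ₗ (mfderiv 𝓘(ℂ) 𝓘(ℂ) σ.symm x).toLinearMap

end Action

/-! ### Sections of `K_S(2Δ)` on `S = C × C` -/

section Square

variable (C : Type*) [TopologicalSpace C] [ChartedSpace ℂ C]

/-- The tangent space `T_p S = T_x C × T_y C` of `S = C × C` at `p = (x, y)`. -/
abbrev TS {C : Type*} [TopologicalSpace C] [ChartedSpace ℂ C] (p : C × C) :=
  TangentSpace (𝓘(ℂ).prod 𝓘(ℂ)) p

/-- Forms of type `(2,0)` on `S`, without regularity assumption: sections of `K_S`. -/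
abbrev Form20 := (p : C × C) → (TS p [⋀^Fin 2]→L[ℂ] ℂ)

variable {C}

/-- The vector `(u, v) ∈ T_{(x,y)} S`, for `u ∈ T_x C` and `v ∈ T_y C`. -/
def pair {x y : C} (u : T x) (v : T y) : TS (x, y) := ((u, v) : ℂ × ℂ)

/-- The coefficient `b` of `β = b(z, w) dz ∧ dw` in the chart `(z, w) = e × f` of `S`. -/
def coeff₂ (e f : OpenPartialHomeomorph C ℂ) (β : Form20 C) (q : ℂ × ℂ) : ℂ :=
  β (e.symm q.1, f.symm q.2) ![pair (ddz e q.1) 0, pair 0 (ddz f q.2)]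

variable (C) in
/-- `H⁰(S, K_S(2Δ))`: the 2-forms that are holomorphic on `S ∖ Δ` and have at most a double pole
along the diagonal `Δ`, whose equation in a chart `(z, w) = e × e` is `z - w = 0`. They are
represented by sections of `K_S` that take the value `0` on `Δ`, so that equality in this space is
equality on `S ∖ Δ`. -/
def H0L : Submodule ℂ (Form20 C) where
  carrier := {β | (∀ x, β (x, x) = 0) ∧
    (∀ e ∈ Charts C, ∀ f ∈ Charts C, DifferentiableOn ℂ (coeff₂ e f β)
      {q | q.1 ∈ e.target ∧ q.2 ∈ f.target ∧ e.symm q.1 ≠ f.symm q.2}) ∧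
    ∀ e ∈ Charts C, ∃ g : ℂ × ℂ → ℂ, DifferentiableOn ℂ g (e.target ×ˢ e.target) ∧
      ∀ q ∈ e.target ×ˢ e.target, q.1 ≠ q.2 → (q.1 - q.2) ^ 2 * coeff₂ e e β q = g q}
  zero_mem' := ⟨fun _ => rfl, fun _ _ _ _ => differentiableOn_const (0 : ℂ),
    fun _ _ => ⟨fun _ => 0, differentiableOn_const _, fun _ _ _ => mul_zero _⟩⟩
  add_mem' := by
    rintro a b ⟨ha0, ha1, ha2⟩ ⟨hb0, hb1, hb2⟩
    refine ⟨fun x => by simp [ha0, hb0], fun e he f hf => (ha1 e he f hf).add (hb1 e he f hf),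
      fun e he => ?_⟩
    obtain ⟨g, hg, hE⟩ := ha2 e he
    obtain ⟨k, hk, hF⟩ := hb2 e he
    refine ⟨g + k, hg.add hk, fun q hq hne => ?_⟩
    rw [Pi.add_apply, ← hE q hq hne, ← hF q hq hne, ← mul_add]
    rfl
  smul_mem' := by
    rintro c a ⟨ha0, ha1, ha2⟩
    refine ⟨fun x => by simp [ha0], fun e he f hf => (ha1 e he f hf).const_smul c,
      fun e he => ?_⟩
    obtain ⟨g, hg, hE⟩ := ha2 e he
    refine ⟨c • g, hg.const_smul c, fun q hq hne => ?_⟩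
    rw [Pi.smul_apply, ← hE q hq hne, smul_eq_mul, mul_left_comm]
    rfl

/-- The section `β` of `K_S(2Δ)` corresponds to the section `α` of `E`:
`α_x(u)(v) = β((u, 0), (0, v))` for `x ≠ y`, `u ∈ T_x C` and `v ∈ T_y C`. -/
def Corresponds (α : (x : C) → E x) (β : H0L C) : Prop :=
  ∀ x y : C, x ≠ y → ∀ (u : T x) (v : T y),
    (α x u : Form10 C) y v = (β : Form20 C) (x, y) ![pair u 0, pair 0 v]

open scoped Classical in
/-- The section `η̂` of `K_S(2Δ)` that corresponds to the section `η` of `E`. -/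
def etaHat (C : Type*) [TopologicalSpace C] [ChartedSpace ℂ C] [T2Space C]
    [IsManifold 𝓘(ℂ) ω C] : H0L C :=
  if h : ∃ β : H0L C, Corresponds (fun x : C => eta x) β then h.choose else 0

/-- The pull-back `(τ × τ)^* β`. -/
def pullback₂ (τ : Aut C) : Form20 C →ₗ[ℂ] Form20 C where
  toFun β p := (β (Prod.map τ τ p)).compContinuousLinearMap
    (mfderiv (𝓘(ℂ).prod 𝓘(ℂ)) (𝓘(ℂ).prod 𝓘(ℂ)) (Prod.map τ τ) p)
  map_add' _ _ := by ext; rfl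
  map_smul' _ _ := by ext; rfl

theorem coeff₂_pullback₂ [IsManifold 𝓘(ℂ) ω C] (τ : Aut C) (β : Form20 C)
    {e f : OpenPartialHomeomorph C ℂ} (he : e ∈ Charts C) (hf : f ∈ Charts C) {q : ℂ × ℂ}
    (h1 : q.1 ∈ e.target) (h2 : q.2 ∈ f.target) :
    coeff₂ e f (pullback₂ τ β) q = coeff₂ (moveChart τ e) (moveChart τ f) β q := by
  have hτ : ∀ y, HasMFDerivAt 𝓘(ℂ) 𝓘(ℂ) τ y (mfderiv 𝓘(ℂ) 𝓘(ℂ) τ y) := fun y =>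
    (τ.contMDiff.mdifferentiable (by simp) y).hasMFDerivAt
  have hd : ∀ (x y : C), mfderiv (𝓘(ℂ).prod 𝓘(ℂ)) (𝓘(ℂ).prod 𝓘(ℂ)) (Prod.map τ τ) (x, y)
      = (mfderiv 𝓘(ℂ) 𝓘(ℂ) τ x).prodMap (mfderiv 𝓘(ℂ) 𝓘(ℂ) τ y) := fun x y =>
    (HasMFDerivAt.prodMap (p := (x, y)) (hτ x) (hτ y)).mfderiv
  have hv : ∀ (x y : C) (u : T x) (v : T y),
      mfderiv (𝓘(ℂ).prod 𝓘(ℂ)) (𝓘(ℂ).prod 𝓘(ℂ)) (Prod.map τ τ) (x, y) (pair u v)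
        = pair (mfderiv 𝓘(ℂ) 𝓘(ℂ) τ x u) (mfderiv 𝓘(ℂ) 𝓘(ℂ) τ y v) := fun x y u v => by
    rw [hd]; rfl
  unfold coeff₂
  rw [ddz_moveChart τ he h1, ddz_moveChart τ hf h2]
  change (β (τ (e.symm q.1), τ (f.symm q.2))) _ = (β (τ (e.symm q.1), τ (f.symm q.2))) _
  congr 1
  funext i
  fin_cases i
  · exact (hv _ _ _ _).trans (congrArg (pair _) (map_zero _))
  · exact (hv _ _ _ _).trans (congrArg (fun w => pair w _) (map_zero _))

theorem pullback₂_mem [IsManifold 𝓘(ℂ) ω C] (τ : Aut C) {β : Form20 C} (hβ : β ∈ H0L C) :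
    pullback₂ τ β ∈ H0L C := by
  obtain ⟨h0, h1, h2⟩ := hβ
  refine ⟨fun x => ?_, fun e he f hf => ?_, fun e he => ?_⟩
  · change (β (τ x, τ x)).compContinuousLinearMap _ = 0
    rw [h0]
    rfl
  · refine ((h1 _ (moveChart_mem τ he) _ (moveChart_mem τ hf)).mono ?_).congr
      fun q hq => coeff₂_pullback₂ τ β he hf hq.1 hq.2.1
    exact fun q hq => ⟨hq.1, hq.2.1, fun h => hq.2.2 (τ.injective h)⟩
  · obtain ⟨g, hg, hE⟩ := h2 _ (moveChart_mem τ he)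
    exact ⟨g, hg, fun q hq hne => by
      rw [coeff₂_pullback₂ τ β he he hq.1 hq.2]
      exact hE q hq hne⟩

/-- The action of `Aut(C)` on `H⁰(S, K_S(2Δ))` induced by the diagonal action on `S`:
`σ · β = (σ⁻¹ × σ⁻¹)^* β`. -/
def actL [IsManifold 𝓘(ℂ) ω C] (σ : Aut C) : H0L C →ₗ[ℂ] H0L C :=
  (pullback₂ σ.symm).restrict fun _ => pullback₂_mem σ.symm

end Square

end RiemannSurface

end

noncomputable section

namespace RiemannSurface

/-! ### Local primitives on a punctured disc. -/

section LocalAnalysis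

open ComplexConjugate

/-! The form `phi x` is characterised by two conditions, membership in `etaLine x` and a normalised
principal part, so invariance follows from uniqueness once an automorphism τ is seen to respect
both. Pull-back preserves closed forms, type (0,1) and exactness off the point, hence the lines
(`pullbackV_mem_etaLine`). It changes the leading coefficient of the pole by the derivative τ' in
the preferred charts, whence τ' · τ^*φ_{τx} = φ_x (`smul_pullbackV_phi`). Since dz(dτ u) = τ' dz(u)
as well, the linear map η_x is invariant.

Uniqueness (`eq_of_mem_etaLine_of_hasPrincipalPart`): a difference ψ of two candidates has no pole,
and ψ - β = df off x with β closed of type (0,1) on C. Locally f is holomorphic plus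
antiholomorphic, so it extends over x and is constant by the maximum principle. Then ψ = β is both
linear and antilinear, hence 0.

For η̂: the correspondence with sections of E is equivariant, and a section of K_S(2Δ) is determined
by its values on pairs (u, 0), (0, v) off the diagonal.

`phi` and `etaHat` are defined with default value 0. Existence is not needed: an automorphism
carries the default case to itself. -/

/-- The punctured disc is the image of a half-plane under w ↦ c + exp w. Connectedness makes a
function with zero derivative there constant. -/
theorem isPreconnected_ball_diff_center (c : ℂ) (r : ℝ) :
    IsPreconnected (Metric.ball c r \ {c}) := by
  rcases le_or_gt r 0 with hr | hr
  · rw [Metric.ball_eq_empty.2 hr, Set.empty_sdiff]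
    exact isPreconnected_empty
  have himg : (fun w : ℂ => c + Complex.exp w) '' {w | w.re < Real.log r}
      = Metric.ball c r \ {c} := by
    ext z
    constructor
    · rintro ⟨w, hw, rfl⟩
      refine ⟨?_, ?_⟩
      · rw [Metric.mem_ball, dist_eq_norm, add_sub_cancel_left, Complex.norm_exp]
        exact (Real.lt_log_iff_exp_lt hr).1 hw
      · simp [Complex.exp_ne_zero]
    · rintro ⟨hz, hne⟩
      have hz0 : z - c ≠ 0 := sub_ne_zero.2 hne
      refine ⟨Complex.log (z - c), ?_, ?_⟩
      · change (Complex.log (z - c)).re < Real.log r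
        rw [Complex.log_re]
        exact Real.log_lt_log (norm_pos_iff.2 hz0) (by rwa [← dist_eq_norm])
      · change c + Complex.exp (Complex.log (z - c)) = z
        rw [Complex.exp_log hz0, add_sub_cancel]
  rw [← himg]
  exact (convex_halfSpace_re_lt _).isPreconnected.image _ (by fun_prop)

/-- A closed form of type `(0,1)` is the conjugate of a holomorphic form. -/
theorem differentiableAt_conj_of_closed {β : ℂ → ℂ →L[ℝ] ℂ} {z : ℂ} {s : Set ℂ} (hs : s ∈ 𝓝 z)
    (hβ : DifferentiableAt ℝ β z)
    (hanti : ∀ z ∈ s, ∀ v, β z (Complex.I * v) = -Complex.I * β z v)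
    (hcl : ∀ v w, fderiv ℝ β z v w = fderiv ℝ β z w v) :
    DifferentiableAt ℂ (fun z => conj (β z 1)) z := by
  have hd : ∀ u : ℂ, HasFDerivAt (fun y => β y u) ((fderiv ℝ β z).flip u) z := fun u =>
    hβ.hasFDerivAt.clm_apply (hasFDerivAt_const u z) |>.congr_fderiv (by ext; simp)
  -- Antilinearity differentiated in the direction 1. With closedness it gives ∂_y b = -i ∂_x b for
  -- b = β(1), which is the Cauchy-Riemann equation for the conjugate of b.
  have hI : fderiv ℝ β z 1 Complex.I = -Complex.I * fderiv ℝ β z 1 1 := by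
    have h1 : HasFDerivAt (fun y => β y Complex.I)
        ((-Complex.I) • (fderiv ℝ β z).flip 1) z := by
      refine ((hd 1).const_smul (-Complex.I)).congr_of_eventuallyEq ?_
      filter_upwards [hs] with y hy
      simpa using hanti y hy 1
    have := congrArg (fun L : ℂ →L[ℝ] ℂ => L 1) ((hd Complex.I).unique h1)
    simpa using this
  have hc := (Complex.conjCLE.toContinuousLinearMap.hasFDerivAt (x := β z 1)).comp z (hd 1)
  refine (differentiableAt_complex_iff_differentiableAt_real.2 ⟨hc.differentiableAt, ?_⟩)
  have : fderiv ℝ (fun z => conj (β z 1)) z = _ := hc.fderiv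
  rw [this]
  simp [hcl Complex.I 1, hI]

theorem hasFDerivAt_real_of_hasDerivAt {f : ℂ → ℂ} {f' z : ℂ} (h : HasDerivAt f f' z) :
    HasFDerivAt f (ContinuousLinearMap.mul ℝ ℂ f') z :=
  (h.hasFDerivAt.restrictScalars ℝ).congr_fderiv (by ext v; simp [mul_comm])

/-- A primitive on a punctured disc of a form `a dz - β`, with `a` holomorphic and `β` closed of
type `(0,1)` on the whole disc, is the sum of a holomorphic and an antiholomorphic function on the
disc. -/
theorem exists_holomorphic_add_conj {c : ℂ} {r : ℝ} (hr : 0 < r) {a F : ℂ → ℂ}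
    {β : ℂ → ℂ →L[ℝ] ℂ} (ha : DifferentiableOn ℂ a (Metric.ball c r))
    (hβ : ∀ z ∈ Metric.ball c r, DifferentiableAt ℝ β z)
    (hanti : ∀ z ∈ Metric.ball c r, ∀ v, β z (Complex.I * v) = -Complex.I * β z v)
    (hcl : ∀ z ∈ Metric.ball c r, ∀ v w, fderiv ℝ β z v w = fderiv ℝ β z w v)
    (hF : ∀ z ∈ Metric.ball c r \ {c},
      HasFDerivAt F (ContinuousLinearMap.mul ℝ ℂ (a z) - β z) z) :
    ∃ G K : ℂ → ℂ, AnalyticAt ℂ G c ∧ AnalyticAt ℂ K c ∧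
      ∀ᶠ z in 𝓝[≠] c, F z = G z + conj (K z) := by
  have hB : ∀ z ∈ Metric.ball c r, Metric.ball c r ∈ 𝓝 z := fun z hz =>
    Metric.isOpen_ball.mem_nhds hz
  have hk : DifferentiableOn ℂ (fun z => conj (β z 1)) (Metric.ball c r) := fun z hz =>
    (differentiableAt_conj_of_closed (hB z hz) (hβ z hz) hanti
      (hcl z hz)).differentiableWithinAt
  obtain ⟨G, hG⟩ := ha.isExactOn_ball
  obtain ⟨K, hK⟩ := hk.isExactOn_ball
  have hc := Metric.mem_ball_self (x := c) hr
  have han : ∀ {f f' : ℂ → ℂ}, (∀ z ∈ Metric.ball c r, HasDerivAt f (f' z) z) →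
      AnalyticAt ℂ f c := fun h =>
    DifferentiableOn.analyticAt (fun z hz => (h z hz).differentiableAt.differentiableWithinAt)
      (hB c hc)
  -- Antilinearity means β = β(1) dz̄. As K' is the conjugate of β(1), conj K is a primitive of β,
  -- and G - conj K one of a dz - β.
  have hD : ∀ z ∈ Metric.ball c r \ {c},
      HasFDerivAt (fun z => F z - (G z - conj (K z))) (0 : ℂ →L[ℝ] ℂ) z := by
    intro z hz
    have h1 := hasFDerivAt_real_of_hasDerivAt (hG z hz.1)
    have h2 := Complex.conjCLE.toContinuousLinearMap.hasFDerivAt.comp z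
      (hasFDerivAt_real_of_hasDerivAt (hK z hz.1))
    refine ((hF z hz).sub (h1.sub h2)).congr_fderiv ?_
    have hanti' := hanti z hz.1
    have : ∀ v : ℂ, β z v = conj v * β z 1 := by
      intro v
      have h3 : v = (v.re : ℝ) • (1 : ℂ) + (v.im : ℝ) • (Complex.I * 1) := by
        apply Complex.ext <;> simp
      have h4 : conj v = v.re - v.im * Complex.I := by
        apply Complex.ext <;> simp
      conv_lhs => rw [h3]
      rw [map_add, map_smul, map_smul, hanti', h4, Complex.real_smul, Complex.real_smul]
      ring
    ext v
    simp [this v, mul_comm]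
  have ho : IsOpen (Metric.ball c r \ {c}) := Metric.isOpen_ball.sdiff isClosed_singleton
  obtain ⟨A, hA⟩ := ho.exists_is_const_of_fderiv_eq_zero (isPreconnected_ball_diff_center c r)
    (fun z hz => (hD z hz).differentiableAt.differentiableWithinAt) fun z hz => (hD z hz).fderiv
  refine ⟨fun z => G z + A, fun z => -K z, (han hG).add analyticAt_const, (han hK).neg, ?_⟩
  filter_upwards [mem_nhdsWithin_of_mem_nhds (hB c hc), self_mem_nhdsWithin] with z hz hne
  have := hA z ⟨hz, hne⟩
  rw [← this, map_neg]
  ring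

end LocalAnalysis

/-! ### Maximum principle for pluriharmonic functions on a compact surface. -/

section MaximumPrinciple

variable {C : Type*} [TopologicalSpace C] [CompactSpace C] [ConnectedSpace C] [ChartedSpace ℂ C]

/-- The set where the maximum is attained is closed by continuity and open because |exp H| = e^u:
the maximum modulus principle makes exp H, hence u, locally constant there. -/
theorem eq_of_locally_re_analytic {u : C → ℝ}
    (hu : ∀ p : C, ∃ H : ℂ → ℂ, AnalyticAt ℂ H (chartAt ℂ p p) ∧
      ∀ᶠ y in 𝓝 p, u y = (H (chartAt ℂ p y)).re) (p q : C) : u p = u q := by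
  have hchart : ∀ p : C, ContinuousAt (chartAt ℂ p) p := fun p =>
    (chartAt ℂ p).continuousAt (mem_chart_source ℂ p)
  have hcont : Continuous u := continuous_iff_continuousAt.2 fun p => by
    obtain ⟨H, hH, he⟩ := hu p
    refine ContinuousAt.congr ?_ (he.mono fun _ h => h.symm)
    exact Complex.continuous_re.continuousAt.comp
      (ContinuousAt.comp (f := chartAt ℂ p) hH.continuousAt (hchart p))
  obtain ⟨m, -, hm⟩ := isCompact_univ.exists_isMaxOn Set.univ_nonempty hcont.continuousOn
  have hclosed : IsClosed {y | u y = u m} := isClosed_eq hcont continuous_const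
  have hopen : IsOpen {y | u y = u m} := by
    refine isOpen_iff_mem_nhds.2 fun p (hp : u p = u m) => ?_
    obtain ⟨H, hH, he⟩ := hu p
    set e := chartAt ℂ p
    have hsymm : ContinuousAt e.symm (e p) := e.continuousAt_symm (mem_chart_target ℂ p)
    have hinv : e.symm (e p) = p := e.left_inv (mem_chart_source ℂ p)
    have he' : ∀ᶠ z in 𝓝 (e p), u (e.symm z) = (H z).re := by
      have h1 : ∀ᶠ z in 𝓝 (e p), u (e.symm z) = (H (e (e.symm z))).re :=
        hsymm.eventually (by rwa [hinv])
      filter_upwards [h1, e.open_target.mem_nhds (mem_chart_target ℂ p)] with z h2 h3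
      rw [h2, e.right_inv h3]
    have hval := he'.self_of_nhds
    rw [hinv] at hval
    have hmax : IsLocalMax (norm ∘ fun z => Complex.exp (H z)) (e p) := by
      filter_upwards [he'] with z hz
      simp only [Function.comp_apply, Complex.norm_exp]
      rw [← hz, ← hval, hp]
      exact Real.exp_le_exp.2 (hm (Set.mem_univ _))
    have hdiff : ∀ᶠ z in 𝓝 (e p), DifferentiableAt ℂ (fun z => Complex.exp (H z)) z := by
      filter_upwards [hH.eventually_analyticAt] with z hz
      exact hz.differentiableAt.cexp
    have hconst := Complex.eventually_eq_of_isLocalMax_norm hdiff hmax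
    filter_upwards [he, (hchart p).eventually hconst] with y h1 h2
    have h3 := congrArg norm h2
    simp only [Complex.norm_exp, Real.exp_eq_exp] at h3
    change u y = u m
    rw [h1, h3, ← hval, hp]
  have huniv := IsClopen.eq_univ ⟨hclosed, hopen⟩ ⟨m, rfl⟩
  have hall : ∀ y, u y = u m := fun y => by
    have : y ∈ {y | u y = u m} := huniv ▸ Set.mem_univ y
    exact this
  rw [hall p, hall q]

open ComplexConjugate in
-- Re(G + conj K) = Re(G + K) and Im(G + conj K) = Re(-i(G - K)), so the real case applies to both
-- parts.
theorem eq_of_locally_analytic_add_conj {u : C → ℂ}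
    (hu : ∀ p : C, ∃ G K : ℂ → ℂ, AnalyticAt ℂ G (chartAt ℂ p p) ∧
      AnalyticAt ℂ K (chartAt ℂ p p) ∧
      ∀ᶠ y in 𝓝 p, u y = G (chartAt ℂ p y) + conj (K (chartAt ℂ p y))) (p q : C) :
    u p = u q := by
  refine Complex.ext ?_ ?_
  · refine eq_of_locally_re_analytic (u := fun y => (u y).re) (fun p => ?_) p q
    obtain ⟨G, K, hG, hK, h⟩ := hu p
    refine ⟨fun z => G z + K z, hG.add hK, h.mono fun y hy => ?_⟩
    simp [hy]
  · refine eq_of_locally_re_analytic (u := fun y => (u y).im) (fun p => ?_) p q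
    obtain ⟨G, K, hG, hK, h⟩ := hu p
    refine ⟨fun z => -Complex.I * (G z - K z), analyticAt_const.mul (hG.sub hK),
      h.mono fun y hy => ?_⟩
    simp [hy, sub_eq_add_neg]

end MaximumPrinciple

/-! ### Passage from complex to real derivatives. -/

section RealStructure

variable {C D : Type*} [TopologicalSpace C] [ChartedSpace ℂ C] [TopologicalSpace D]
  [ChartedSpace ℂ D]

theorem hasMFDerivAt_realify {f : C → D} {x : C} {f' : ℂ →L[ℂ] ℂ}
    (h : HasMFDerivAt 𝓘(ℂ) 𝓘(ℂ) f x f') :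
    HasMFDerivAt 𝓘(ℝ, ℂ) 𝓘(ℝ, ℂ) f x (realify f') :=
  ⟨h.1, HasFDerivWithinAt.restrictScalars ℝ h.2⟩

theorem contMDiffAt_real {f : C → D} {x : C} {n : ℕ∞ω} (h : ContMDiffAt 𝓘(ℂ) 𝓘(ℂ) n f x) :
    ContMDiffAt 𝓘(ℝ, ℂ) 𝓘(ℝ, ℂ) n f x := by
  rw [contMDiffAt_iff] at h ⊢
  exact ⟨h.1, ContDiffWithinAt.restrict_scalars ℝ h.2⟩

theorem aut_hasMFDerivAt (τ : Aut C) (y : C) :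
    HasMFDerivAt 𝓘(ℂ) 𝓘(ℂ) τ y (mfderiv 𝓘(ℂ) 𝓘(ℂ) τ y) :=
  (τ.contMDiff.mdifferentiable (by simp) y).hasMFDerivAt

theorem aut_mfderiv_real (τ : Aut C) (y : C) :
    mfderiv 𝓘(ℝ, ℂ) 𝓘(ℝ, ℂ) τ y = realify (mfderiv 𝓘(ℂ) 𝓘(ℂ) τ y) :=
  (hasMFDerivAt_realify (aut_hasMFDerivAt τ y)).mfderiv

variable [IsManifold 𝓘(ℂ) ω C]

theorem hasMFDerivAt_real_symm {e : OpenPartialHomeomorph C ℂ} (he : e ∈ Charts C) {z : ℂ}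
    (hz : z ∈ e.target) : HasMFDerivAt 𝓘(ℝ, ℂ) 𝓘(ℝ, ℂ) e.symm z
      (realify (mfderiv 𝓘(ℂ) 𝓘(ℂ) e.symm z)) :=
  hasMFDerivAt_realify (mdifferentiableAt_symm he hz).hasMFDerivAt

theorem inChart_forms01 {e : OpenPartialHomeomorph C ℂ} (he : e ∈ Charts C) {β : Form1 C}
    (hβ : β ∈ forms01 C) {z : ℂ} (hz : z ∈ e.target) (v : ℂ) :
    inChart e β z (Complex.I * v) = -Complex.I * inChart e β z v := by
  unfold inChart
  rw [(hasMFDerivAt_real_symm he hz).mfderiv]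
  have h : ∀ (L : ℂ →L[ℝ] ℂ) (M : ℂ →L[ℂ] ℂ),
      (∀ v, L (Complex.I * v) = -Complex.I * L v) →
      (L.comp (realify M)) (Complex.I * v) = -Complex.I * (L.comp (realify M)) v := by
    intro L M hL
    change L (M (Complex.I * v)) = -Complex.I * L (M v)
    rw [← smul_eq_mul, map_smul, smul_eq_mul, hL]
  exact h _ _ (hβ (e.symm z))

end RealStructure

/-! ### The lines j_x⁻¹(H^{0,1}) and their pull-backs. -/

section EtaLine

variable {C : Type*} [TopologicalSpace C] [ChartedSpace ℂ C]

/-- Two classes in H¹(C ∖ {x}) agree when representatives differ by an exact form; this replaces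
cohomology by forms, on which pull-back is explicit. -/
theorem mem_etaLine_iff [T2Space C] [IsManifold 𝓘(ℂ) ω C] {x : C} {φ : H0K2 x} :
    φ ∈ etaLine x ↔ ∃ β ∈ closedForms (⊤ : TopologicalSpace.Opens C), β ∈ forms01 C ∧
      toForm1 (φ : Form10 C) - β ∈ exactForms (punctured x) := by
  constructor
  · rintro ⟨-, ⟨β, hβ, rfl⟩, h⟩
    refine ⟨β, β.2, hβ, ?_⟩
    have h1 := (Submodule.Quotient.eq _).1 h.symm
    exact h1
  · rintro ⟨β, hβ, hβ', h⟩
    refine ⟨_, ⟨⟨β, hβ⟩, hβ', rfl⟩, ?_⟩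
    refine Eq.symm ((Submodule.Quotient.eq _).2 ?_)
    exact h

/-- The pull-back of complex valued 1-forms. -/
def pullbackReal (τ : Aut C) : Form1 C →ₗ[ℂ] Form1 C where
  toFun β y := (β (τ y)).comp (mfderiv 𝓘(ℝ, ℂ) 𝓘(ℝ, ℂ) τ y)
  map_add' _ _ := by ext; rfl
  map_smul' _ _ := by ext; rfl

theorem toForm1_pullback (τ : Aut C) (α : Form10 C) :
    toForm1 (pullback τ α) = pullbackReal τ (toForm1 α) := by
  funext y
  change _ = (toForm1 α (τ y)).comp (mfderiv 𝓘(ℝ, ℂ) 𝓘(ℝ, ℂ) τ y)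
  rw [aut_mfderiv_real]
  rfl

theorem inChart_pullbackReal [IsManifold 𝓘(ℂ) ω C] (τ : Aut C) (β : Form1 C)
    {e : OpenPartialHomeomorph C ℂ} (he : e ∈ Charts C) {z : ℂ} (hz : z ∈ e.target) :
    inChart e (pullbackReal τ β) z = inChart (moveChart τ e) β z := by
  have h : mfderiv 𝓘(ℝ, ℂ) 𝓘(ℝ, ℂ) (moveChart τ e).symm z = _ :=
    ((hasMFDerivAt_realify (aut_hasMFDerivAt τ (e.symm z))).comp z (hasMFDerivAt_real_symm he hz)).mfderiv
  unfold inChart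
  rw [h, (hasMFDerivAt_real_symm he hz).mfderiv]
  change ((β (τ (e.symm z))).comp (mfderiv 𝓘(ℝ, ℂ) 𝓘(ℝ, ℂ) τ (e.symm z))).comp _ = _
  rw [aut_mfderiv_real]
  rfl

theorem pullbackReal_mem_closedForms [IsManifold 𝓘(ℂ) ω C] (τ : Aut C) {β : Form1 C}
    (hβ : β ∈ closedForms (⊤ : TopologicalSpace.Opens C)) :
    pullbackReal τ β ∈ closedForms (⊤ : TopologicalSpace.Opens C) := by
  intro e he
  obtain ⟨h1, h2⟩ := hβ _ (moveChart_mem τ he)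
  have heq : Set.EqOn (inChart e (pullbackReal τ β)) (inChart (moveChart τ e) β) e.target :=
    fun z hz => inChart_pullbackReal τ β he hz
  refine ⟨(h1.congr fun z hz => heq hz.1), fun z hz v w => ?_⟩
  rw [(heq.eventuallyEq_of_mem (e.open_target.mem_nhds hz.1)).fderiv_eq]
  exact h2 z hz v w

theorem pullbackReal_mem_forms01 (τ : Aut C) {β : Form1 C} (hβ : β ∈ forms01 C) :
    pullbackReal τ β ∈ forms01 C := by
  intro y v
  have h : ∀ (L : ℂ →L[ℝ] ℂ) (M : ℂ →L[ℂ] ℂ) (N : ℂ →L[ℝ] ℂ), N = realify M →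
      (∀ v, L (Complex.I * v) = -Complex.I * L v) →
      (L.comp N) (Complex.I * v) = -Complex.I * (L.comp N) v := by
    rintro L M N rfl hL
    change L (M (Complex.I * v)) = -Complex.I * L (M v)
    rw [← smul_eq_mul, map_smul, smul_eq_mul, hL]
  exact h (β (τ y)) _ _ (aut_mfderiv_real τ y) (hβ (τ y))

theorem pullbackReal_mem_exactForms [T2Space C] (τ : Aut C) (x : C) {β : Form1 C}
    (hβ : β ∈ exactForms (punctured (τ x))) : pullbackReal τ β ∈ exactForms (punctured x) := by
  obtain ⟨f, hf, hd⟩ := hβ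
  have hmaps : ∀ y ∈ punctured x, τ y ∈ punctured (τ x) := fun y hy h => hy (τ.injective h)
  refine ⟨f ∘ τ, hf.comp ?_ hmaps, fun y hy => ?_⟩
  · exact fun y _ => (contMDiffAt_real ((τ.contMDiff y).of_le le_top)).contMDiffWithinAt
  · have h1 := ((hf.contMDiffAt ((punctured (τ x)).isOpen.mem_nhds
      (hmaps y hy))).mdifferentiableAt (by simp)).hasMFDerivAt
    rw [(h1.comp y (hasMFDerivAt_realify (aut_hasMFDerivAt τ y))).mfderiv, ← hd _ (hmaps y hy),
      ← aut_mfderiv_real]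
    rfl

theorem pullbackV_mem_etaLine [T2Space C] [IsManifold 𝓘(ℂ) ω C] (τ : Aut C) (x : C)
    {φ : H0K2 (τ x)} (hφ : φ ∈ etaLine (τ x)) :
    pullbackV τ x φ ∈ etaLine x := by
  obtain ⟨β, h1, h2, h3⟩ := mem_etaLine_iff.1 hφ
  refine mem_etaLine_iff.2 ⟨pullbackReal τ β, pullbackReal_mem_closedForms τ h1,
    pullbackReal_mem_forms01 τ h2, ?_⟩
  have h4 := pullbackReal_mem_exactForms τ x h3
  rw [map_sub, ← toForm1_pullback] at h4
  exact h4

end EtaLine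

/-! ### Principal parts of double poles. -/

section PrincipalPart

variable {C : Type*} [TopologicalSpace C] [ChartedSpace ℂ C]

/-- In the chart `z = e` at `x`, `φ = (1/(z - z(x))² + h(z)) dz` near `x` with `h` holomorphic. -/
def HasLocalPrincipalPart (e : OpenPartialHomeomorph C ℂ) (x : C) (φ : Form10 C) : Prop :=
  ∃ h : ℂ → ℂ, AnalyticAt ℂ h (e x) ∧
    ∀ᶠ z in 𝓝[≠] (e x), coeff e φ z = 1 / (z - e x) ^ 2 + h z

/-- `t' / (t - t(w₀))² - 1 / (t'(w₀) (w - w₀)²)` is holomorphic at `w₀` for a local coordinate `t`: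
up to sign it is the derivative of `1 / (t - t(w₀)) - 1 / (t'(w₀) (w - w₀))`. -/
theorem exists_analyticAt_deriv_div_sq {t : ℂ → ℂ} {w₀ : ℂ} (ht : AnalyticAt ℂ t w₀)
    (h0 : deriv t w₀ ≠ 0) : ∃ k : ℂ → ℂ, AnalyticAt ℂ k w₀ ∧ ∀ᶠ w in 𝓝[≠] w₀,
      deriv t w / (t w - t w₀) ^ 2 = (deriv t w₀)⁻¹ * (1 / (w - w₀) ^ 2) + k w := by
  set a := deriv t w₀
  have hq : AnalyticAt ℂ (dslope t w₀) w₀ := by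
    obtain ⟨p, hp⟩ := ht
    exact ⟨_, hp.has_fpower_series_dslope_fslope⟩
  have hqa : dslope t w₀ w₀ = a := dslope_same t w₀
  set s : ℂ → ℂ := fun w => (dslope t w₀ w)⁻¹ with hs_def
  have hs : AnalyticAt ℂ s w₀ := hq.inv (by rwa [hqa])
  have hsa : s w₀ = a⁻¹ := by rw [hs_def]; simp only [hqa]
  -- Off w₀ one has s = (w - w₀)/(t - t(w₀)), so its slope from w₀ is 1/(t - t(w₀)) - 1/(a(w - w₀));
  -- analyticity of `dslope` removes the singularity.
  have hr : AnalyticAt ℂ (dslope s w₀) w₀ := by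
    obtain ⟨p, hp⟩ := hs
    exact ⟨_, hp.has_fpower_series_dslope_fslope⟩
  refine ⟨fun w => -deriv (dslope s w₀) w, hr.deriv.neg, ?_⟩
  have hne : ∀ᶠ w in 𝓝 w₀, dslope t w₀ w ≠ 0 :=
    hq.continuousAt.eventually_ne (by rwa [hqa])
  filter_upwards [mem_nhdsWithin_of_mem_nhds hne, self_mem_nhdsWithin,
    mem_nhdsWithin_of_mem_nhds ht.eventually_analyticAt] with w hw hww hta
  have hww0 : w - w₀ ≠ 0 := sub_ne_zero.2 hww
  have hdt : t w - t w₀ ≠ 0 := by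
    rw [← sub_smul_dslope t w₀ w]
    exact smul_ne_zero hww0 hw
  have hev : dslope s w₀ =ᶠ[𝓝 w] fun v => (t v - t w₀)⁻¹ - a⁻¹ * (v - w₀)⁻¹ := by
    filter_upwards [isOpen_ne.mem_nhds hww] with v hv
    have hv0 : v - w₀ ≠ 0 := sub_ne_zero.2 hv
    rw [dslope_of_ne _ hv, slope_def_field, hsa, hs_def]
    simp only
    rw [dslope_of_ne _ hv, slope_def_field, inv_div]
    field_simp
  have hder : HasDerivAt (fun v => (t v - t w₀)⁻¹ - a⁻¹ * (v - w₀)⁻¹)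
      (-deriv t w / (t w - t w₀) ^ 2 - a⁻¹ * (-1 / (w - w₀) ^ 2)) w :=
    ((hta.differentiableAt.hasDerivAt.sub_const _).inv hdt).sub
      ((((hasDerivAt_id w).sub_const w₀).inv hww0).const_mul _)
  rw [hev.deriv_eq, hder.deriv]
  ring

variable [IsManifold 𝓘(ℂ) ω C]

/-- τ^*φ in the chart e and φ in the chart e ∘ τ⁻¹ have the same coefficient function near the
point. -/
theorem hasLocalPrincipalPart_pullback (τ : Aut C) {e : OpenPartialHomeomorph C ℂ}
    (he : e ∈ Charts C) {x : C} (hx : x ∈ e.source) {φ : Form10 C} :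
    HasLocalPrincipalPart e x (pullback τ φ) ↔
      HasLocalPrincipalPart (moveChart τ e) (τ x) φ := by
  have hv : moveChart τ e (τ x) = e x := by
    change e (τ.symm (τ x)) = e x
    rw [τ.symm_apply_apply]
  unfold HasLocalPrincipalPart
  rw [hv]
  refine exists_congr fun h => and_congr_right fun _ => ?_
  refine Filter.eventually_congr ?_
  filter_upwards [mem_nhdsWithin_of_mem_nhds (e.open_target.mem_nhds (e.map_source hx))] with z hz
  rw [coeff_pullback τ φ he hz]

end PrincipalPart

/-! ### Change of chart. -/

section Transition

variable {C : Type*} [TopologicalSpace C] [ChartedSpace ℂ C]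

theorem analyticAt_transition {e f : OpenPartialHomeomorph C ℂ} (he : e ∈ Charts C)
    (hf : f ∈ Charts C) {w : ℂ} (hw : w ∈ f.target) (hw' : f.symm w ∈ e.source) :
    AnalyticAt ℂ (e ∘ f.symm) w := by
  have h1 : ContMDiffAt 𝓘(ℂ) 𝓘(ℂ) ω (e ∘ f.symm) w :=
    ((contMDiffOn_of_mem_maximalAtlas he).contMDiffAt (e.open_source.mem_nhds hw')).comp w
      ((contMDiffOn_symm_of_mem_maximalAtlas hf).contMDiffAt (f.open_target.mem_nhds hw))
  exact h1.contDiffAt.analyticAt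

theorem deriv_transition_ne_zero {e f : OpenPartialHomeomorph C ℂ} (he : e ∈ Charts C)
    (hf : f ∈ Charts C) {w : ℂ} (hw : w ∈ f.target) (hw' : f.symm w ∈ e.source) :
    deriv (e ∘ f.symm) w ≠ 0 := by
  have h1 := (analyticAt_transition he hf hw hw').differentiableAt.hasDerivAt
  have hs : e.symm ((e ∘ f.symm) w) ∈ f.source := by
    simpa [e.left_inv hw'] using f.map_target hw
  have h2 := (analyticAt_transition hf he (e.map_source hw') hs).differentiableAt.hasDerivAt
  have h3 : (f ∘ e.symm) ∘ (e ∘ f.symm) =ᶠ[𝓝 w] id := by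
    filter_upwards [f.open_target.mem_nhds hw,
      (f.continuousAt_symm hw).preimage_mem_nhds (e.open_source.mem_nhds hw')] with v hv hv'
    simp only [Function.comp_apply, id]
    rw [e.left_inv hv', f.right_inv hv]
  have h4 := (h2.comp w h1).unique ((hasDerivAt_id w).congr_of_eventuallyEq h3)
  exact right_ne_zero_of_mul (h4 ▸ one_ne_zero)

variable [IsManifold 𝓘(ℂ) ω C]

theorem coeff_change {e f : OpenPartialHomeomorph C ℂ} (he : e ∈ Charts C)
    (hf : f ∈ Charts C) (φ : Form10 C) {w : ℂ} (hw : w ∈ f.target) (hw' : f.symm w ∈ e.source) :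
    coeff f φ w = deriv (e ∘ f.symm) w * coeff e φ ((e ∘ f.symm) w) := by
  have ht := (analyticAt_transition he hf hw hw').differentiableAt
  have h1 : HasMFDerivAt 𝓘(ℂ) 𝓘(ℂ) (e ∘ f.symm) w (fderiv ℂ (e ∘ f.symm) w) :=
    ht.hasFDerivAt.hasMFDerivAt
  have h2 := (mdifferentiableAt_symm he (e.map_source hw')).hasMFDerivAt
  have h3 : f.symm =ᶠ[𝓝 w] e.symm ∘ (e ∘ f.symm) := by
    filter_upwards [(f.continuousAt_symm hw).preimage_mem_nhds (e.open_source.mem_nhds hw')]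
      with v hv
    exact (e.left_inv hv).symm
  have h4 : mfderiv 𝓘(ℂ) 𝓘(ℂ) f.symm w = _ := ((h2.comp w h1).congr_of_eventuallyEq h3).mfderiv
  have h5 : (ddz f w : ℂ) = deriv (e ∘ f.symm) w • (ddz e ((e ∘ f.symm) w) : ℂ) := by
    have key : ∀ (L M N : ℂ →L[ℂ] ℂ), L = M.comp N → L 1 = N 1 • M 1 := by
      rintro L M N rfl
      rw [← map_smul, smul_eq_mul, mul_one]
      rfl
    exact key _ _ _ h4
  -- The two base points are only propositionally equal; all tangent spaces being ℂ, the comparison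
  -- is stated for vectors of ℂ.
  have h6 : ∀ (p q : C), p = q → ∀ v : ℂ, (φ p v : ℂ) = φ q v := by
    rintro p _ rfl v
    rfl
  have h7 : coeff f φ w = φ (e.symm ((e ∘ f.symm) w)) (ddz f w : ℂ) :=
    h6 _ _ (e.left_inv hw').symm _
  rw [h7, h5]
  exact (φ (e.symm ((e ∘ f.symm) w))).map_smul _ _

/-- With z = t(w), the form dz/(z - z₀)² has leading coefficient 1/t'(w₀) and no residue; the factor
t'(w₀) renormalises it. -/
theorem HasLocalPrincipalPart.change {e f : OpenPartialHomeomorph C ℂ} (he : e ∈ Charts C)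
    (hf : f ∈ Charts C) {x : C} (hxe : x ∈ e.source) (hxf : x ∈ f.source) {φ : Form10 C}
    (h : HasLocalPrincipalPart e x φ) :
    HasLocalPrincipalPart f x (deriv (e ∘ f.symm) (f x) • φ) := by
  obtain ⟨h, hh, hE⟩ := h
  have hw := f.map_source hxf
  have hinv : f.symm (f x) = x := f.left_inv hxf
  have hw' : f.symm (f x) ∈ e.source := by rwa [hinv]
  have ht := analyticAt_transition he hf hw hw'
  have hne := deriv_transition_ne_zero he hf hw hw'
  obtain ⟨k, hk, hK⟩ := exists_analyticAt_deriv_div_sq ht hne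
  have htx : (e ∘ f.symm) (f x) = e x := congrArg e hinv
  set t := e ∘ f.symm with ht_def
  have hsrc : ∀ᶠ w in 𝓝 (f x), w ∈ f.target ∧ f.symm w ∈ e.source :=
    Filter.inter_mem (f.open_target.mem_nhds hw)
      ((f.continuousAt_symm hw).preimage_mem_nhds (e.open_source.mem_nhds hw'))
  have htend : Filter.Tendsto t (𝓝[≠] (f x)) (𝓝[≠] (e x)) := by
    refine tendsto_nhdsWithin_iff.2 ⟨?_, ?_⟩
    · rw [← htx]
      exact ht.continuousAt.tendsto.mono_left nhdsWithin_le_nhds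
    · filter_upwards [mem_nhdsWithin_of_mem_nhds hsrc, self_mem_nhdsWithin] with w hw1 hw2 hw3
      have h1 : f.symm w = x := e.injOn hw1.2 hxe hw3
      exact hw2 (by rw [← h1, f.right_inv hw1.1]; rfl)
  refine ⟨fun w => deriv t (f x) * (k w + deriv t w * h (t w)),
    analyticAt_const.mul (hk.add (ht.deriv.mul (AnalyticAt.comp (by rwa [htx]) ht))), ?_⟩
  filter_upwards [mem_nhdsWithin_of_mem_nhds hsrc, htend.eventually hE, hK] with w h1 h2 h3
  have h4 : coeff f (deriv t (f x) • φ) w = deriv t (f x) * coeff f φ w := rfl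
  rw [h4, coeff_change he hf φ h1.1 h1.2, ← ht_def, h2, mul_add (deriv t w), mul_one_div, ← htx, h3]
  field_simp
  ring

/-- Change of chart controls only a germ at x, whereas `HasPrincipalPart` asks for h on the whole
chart; holomorphy off x bridges the two. -/
theorem hasPrincipalPart_iff [T2Space C] {x : C} {φ : Form10 C} (hφ : IsHolOn φ {x}ᶜ) :
    HasPrincipalPart x φ ↔ HasLocalPrincipalPart (chartAt ℂ x) x φ := by
  have he : chartAt ℂ x ∈ Charts C := IsManifold.chart_mem_maximalAtlas x
  unfold HasPrincipalPart HasLocalPrincipalPart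
  set e := chartAt ℂ x
  have hx : x ∈ e.source := mem_chart_source ℂ x
  have ht := e.open_target.mem_nhds (e.map_source hx)
  constructor
  · rintro ⟨h, hh, hE⟩
    refine ⟨h, hh.analyticAt ht, ?_⟩
    filter_upwards [mem_nhdsWithin_of_mem_nhds ht, self_mem_nhdsWithin] with z hz hne
    exact hE z hz hne
  · rintro ⟨h, hh, hE⟩
    -- At the centre the coefficient and 1/0 carry arbitrary values, so the value of h is put in by
    -- hand.
    refine ⟨Function.update (fun z => coeff e φ z - 1 / (z - e x) ^ 2) (e x) (h (e x)),
      fun z hz => DifferentiableAt.differentiableWithinAt ?_, fun z hz hne => ?_⟩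
    · by_cases hzx : z = e x
      · subst hzx
        refine hh.differentiableAt.congr_of_eventuallyEq ?_
        rw [eventually_nhdsWithin_iff] at hE
        filter_upwards [hE] with z hz'
        by_cases hzx : z = e x
        · rw [hzx, Function.update_self]
        · rw [Function.update_of_ne hzx, hz' hzx, add_sub_cancel_left]
      · have h1 : DifferentiableAt ℂ (coeff e φ) z := by
          refine (hφ e he).differentiableAt
            ((e.isOpen_inter_preimage_symm isOpen_compl_singleton).mem_nhds ⟨hz, ?_⟩)
          intro h2
          exact hzx (by rw [← e.right_inv hz, show e.symm z = x from h2])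
        have h2 : DifferentiableAt ℂ (fun z => coeff e φ z - 1 / (z - e x) ^ 2) z :=
          h1.sub ((differentiableAt_const _).div (by fun_prop)
            (pow_ne_zero 2 (sub_ne_zero.2 hzx)))
        refine h2.congr_of_eventuallyEq ?_
        filter_upwards [isOpen_ne.mem_nhds hzx] with v hv
        rw [Function.update_of_ne hv]
    · rw [Function.update_of_ne hne, add_sub_cancel]

end Transition

/-! ### Uniqueness of the normalised form. -/

section Uniqueness

variable {C : Type*} [TopologicalSpace C] [T2Space C] [CompactSpace C] [ConnectedSpace C]
  [ChartedSpace ℂ C] [IsManifold 𝓘(ℂ) ω C]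

open ComplexConjugate

/-- A form that is holomorphic off `x` and extends holomorphically over `x` vanishes if on `C ∖ {x}`
it is cohomologous to a closed form of type `(0,1)` on `C`. -/
theorem eq_zero_of_sub_mem_exactForms {x : C} {ψ : Form10 C} {β : Form1 C} (h0 : ψ x = 0)
    (hψ : IsHolOn ψ {x}ᶜ)
    (hext : ∃ h : ℂ → ℂ, DifferentiableOn ℂ h (chartAt ℂ x).target ∧
      ∀ z ∈ (chartAt ℂ x).target, z ≠ chartAt ℂ x x → coeff (chartAt ℂ x) ψ z = h z)
    (hβ : β ∈ closedForms (⊤ : TopologicalSpace.Opens C)) (hβ' : β ∈ forms01 C)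
    (hex : toForm1 ψ - β ∈ exactForms (punctured x)) : ψ = 0 := by
  obtain ⟨f, hf, hd⟩ := hex
  have hcharts : ∀ p : C, chartAt ℂ p ∈ Charts C := fun p => IsManifold.chart_mem_maximalAtlas p
  have hfd : ∀ y ≠ x, HasMFDerivAt 𝓘(ℝ, ℂ) 𝓘(ℝ, ℂ) f y (toForm1 ψ y - β y) := fun y hy => by
    have h1 := ((hf.contMDiffAt ((punctured x).isOpen.mem_nhds hy)).mdifferentiableAt
      (by simp)).hasMFDerivAt
    rwa [← hd y hy] at h1
  -- This includes p = x, where `hext` supplies the holomorphic coefficient across the puncture.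
  have hlocal : ∀ p : C, ∃ G K : ℂ → ℂ, AnalyticAt ℂ G (chartAt ℂ p p) ∧
      AnalyticAt ℂ K (chartAt ℂ p p) ∧ ∀ᶠ z in 𝓝[≠] (chartAt ℂ p p),
        (chartAt ℂ p).symm z ≠ x ∧ f ((chartAt ℂ p).symm z) = G z + conj (K z) := by
    intro p
    have hsetup : ∃ (s : Set ℂ) (a : ℂ → ℂ), s ∈ 𝓝 (chartAt ℂ p p) ∧ s ⊆ (chartAt ℂ p).target ∧
        DifferentiableOn ℂ a s ∧ ∀ z ∈ s, z ≠ chartAt ℂ p p →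
          (chartAt ℂ p).symm z ≠ x ∧ coeff (chartAt ℂ p) ψ z = a z := by
      by_cases hpx : p = x
      · subst hpx
        obtain ⟨h, hh, hE⟩ := hext
        refine ⟨_, h, (chartAt ℂ p).open_target.mem_nhds (mem_chart_target ℂ p), subset_rfl, hh,
          fun z hz hne => ⟨fun hzx => hne ?_, hE z hz hne⟩⟩
        rw [← (chartAt ℂ p).right_inv hz, hzx]
      · refine ⟨_, _, ((chartAt ℂ p).isOpen_inter_preimage_symm isOpen_compl_singleton).mem_nhds
          ⟨mem_chart_target ℂ p, ?_⟩, Set.inter_subset_left, hψ _ (hcharts p),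
          fun z hz _ => ⟨hz.2, rfl⟩⟩
        rw [Set.mem_preimage, (chartAt ℂ p).left_inv (mem_chart_source ℂ p)]
        exact hpx
    obtain ⟨s, a, hs, hst, ha, hsa⟩ := hsetup
    obtain ⟨r, hr, hball⟩ := Metric.mem_nhds_iff.1 hs
    set e := chartAt ℂ p
    have he : e ∈ Charts C := hcharts p
    obtain ⟨hβ1, hβ2⟩ := hβ e he
    have htop : ∀ z ∈ Metric.ball (e p) r,
        z ∈ e.target ∩ e.symm ⁻¹' (⊤ : TopologicalSpace.Opens C) := fun z hz =>
      ⟨hst (hball hz), trivial⟩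
    obtain ⟨G, K, hG, hK, hGK⟩ := exists_holomorphic_add_conj (F := f ∘ e.symm)
      (β := inChart e β) hr (ha.mono hball)
      (fun z hz => inChart_contDiffAt_aux hβ1 (htop z hz))
      (fun z hz v => inChart_forms01 he hβ' (hst (hball hz)) v)
      (fun z hz => hβ2 z (htop z hz)) (by
        rintro z ⟨hz, hne⟩
        obtain ⟨h1, h2⟩ := hsa z (hball hz) hne
        have ht := hst (hball hz)
        have h3 := ((hfd _ h1).comp z (hasMFDerivAt_real_symm he ht)).hasFDerivAt
        refine h3.congr_fderiv ?_
        rw [← h2, ← inChart_toForm1 he ψ ht]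
        unfold inChart
        rw [(hasMFDerivAt_real_symm he ht).mfderiv]
        rfl)
    refine ⟨G, K, hG, hK, ?_⟩
    filter_upwards [hGK, mem_nhdsWithin_of_mem_nhds hs, self_mem_nhdsWithin] with z h1 h2 h3
    exact ⟨(hsa z h2 h3).1, h1⟩
  have hcontGK : ∀ {G K : ℂ → ℂ} {c : ℂ}, AnalyticAt ℂ G c → AnalyticAt ℂ K c →
      ContinuousAt (fun z => G z + conj (K z)) c := fun hG hK =>
    hG.continuousAt.add (Complex.continuous_conj.continuousAt.comp hK.continuousAt)
  obtain ⟨c, hc⟩ : ∃ c : ℂ,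
      Filter.Tendsto (f ∘ (chartAt ℂ x).symm) (𝓝[≠] (chartAt ℂ x x)) (𝓝 c) := by
    obtain ⟨G, K, hG, hK, hE⟩ := hlocal x
    refine ⟨_, ((hcontGK hG hK).tendsto.mono_left nhdsWithin_le_nhds).congr' ?_⟩
    filter_upwards [hE] with z hz
    exact hz.2.symm
  classical
  -- Nothing is known about f at x, so its value there is replaced by its limit.
  set u : C → ℂ := Function.update f x c with hu_def
  have hux : ∀ y ≠ x, u y = f y := fun y hy => Function.update_of_ne hy _ _
  have hu : ∀ p : C, ∃ G K : ℂ → ℂ, AnalyticAt ℂ G (chartAt ℂ p p) ∧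
      AnalyticAt ℂ K (chartAt ℂ p p) ∧
      ∀ᶠ y in 𝓝 p, u y = G (chartAt ℂ p y) + conj (K (chartAt ℂ p y)) := by
    intro p
    obtain ⟨G, K, hG, hK, hE⟩ := hlocal p
    refine ⟨G, K, hG, hK, ?_⟩
    have hinv : (chartAt ℂ p).symm (chartAt ℂ p p) = p :=
      (chartAt ℂ p).left_inv (mem_chart_source ℂ p)
    have hE' : u ∘ (chartAt ℂ p).symm =ᶠ[𝓝[≠] (chartAt ℂ p p)] fun z => G z + conj (K z) := by
      filter_upwards [hE] with z hz
      rw [Function.comp_apply, hux _ hz.1, hz.2]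
    have hcont : ContinuousAt (u ∘ (chartAt ℂ p).symm) (chartAt ℂ p p) := by
      by_cases hpx : p = x
      · subst hpx
        rw [continuousAt_iff_punctured_nhds, Function.comp_apply, hinv, hu_def,
          Function.update_self]
        refine hc.congr' ?_
        filter_upwards [hE] with z hz
        exact (hux _ hz.1).symm
      · refine ContinuousAt.comp ?_ ((chartAt ℂ p).continuousAt_symm (mem_chart_target ℂ p))
        rw [hinv]
        exact continuousAt_update_of_ne hpx |>.2 (hfd p hpx).continuousAt
    have hE'' := (hcont.eventuallyEq_nhds_iff_eventuallyEq_nhdsNE (hcontGK hG hK)).1 hE'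
    have hec := (chartAt ℂ p).continuousAt (mem_chart_source ℂ p)
    filter_upwards [hec.eventually hE'',
      (chartAt ℂ p).open_source.mem_nhds (mem_chart_source ℂ p)] with y h1 h2
    rw [← h1, Function.comp_apply, (chartAt ℂ p).left_inv h2]
  have hconst := eq_of_locally_analytic_add_conj hu
  funext y
  by_cases hy : y = x
  · subst hy
    exact h0
  · have h1 : HasMFDerivAt 𝓘(ℝ, ℂ) 𝓘(ℝ, ℂ) f y (0 : ℂ →L[ℝ] ℂ) := by
      refine (hasMFDerivAt_const (u x) y).congr_of_eventuallyEq ?_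
      filter_upwards [isOpen_ne.mem_nhds hy] with v hv
      rw [← hux v hv, hconst v x]
    have h2 : toForm1 ψ y - β y = 0 := hasMFDerivAt_unique (hfd y hy) h1
    -- A map that is both ℂ-linear and antilinear is zero.
    have key : ∀ (L : ℂ →L[ℂ] ℂ) (M : ℂ →L[ℝ] ℂ), (∀ v, M (Complex.I * v) = -Complex.I * M v) →
        realify L - M = 0 → L = 0 := by
      intro L M hM hLM
      have h3 : ∀ v, L v = M v := fun v => by
        have := congrArg (fun N : ℂ →L[ℝ] ℂ => N v) hLM
        exact sub_eq_zero.1 this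
      ext
      have h4 : Complex.I * L 1 = -Complex.I * L 1 := by
        rw [h3 1, ← hM 1, ← h3, ← h3, ← smul_eq_mul, ← smul_eq_mul, map_smul]
      have h5 : (2 * Complex.I) * L 1 = 0 := by linear_combination h4
      simpa using h5
    exact key _ _ (hβ' y) h2

/-- The double poles cancel in the difference, which stays in the subspace `etaLine x`. -/
theorem eq_of_mem_etaLine_of_hasPrincipalPart {x : C} {φ₁ φ₂ : H0K2 x} (h₁ : φ₁ ∈ etaLine x)
    (h₂ : φ₂ ∈ etaLine x) (p₁ : HasPrincipalPart x (φ₁ : Form10 C))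
    (p₂ : HasPrincipalPart x (φ₂ : Form10 C)) : φ₁ = φ₂ := by
  obtain ⟨β, hβ, hβ', hex⟩ := mem_etaLine_iff.1
    ((etaLine x).add_mem h₁ ((etaLine x).smul_mem (-1 : ℂ) h₂))
  obtain ⟨k₁, hk₁, hE₁⟩ := p₁
  obtain ⟨k₂, hk₂, hE₂⟩ := p₂
  have hmem := (φ₁ + (-1 : ℂ) • φ₂).2
  have h0 : (φ₁ : Form10 C) + (-1 : ℂ) • (φ₂ : Form10 C) = 0 := by
    refine eq_zero_of_sub_mem_exactForms hmem.1 hmem.2.1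
      ⟨fun z => k₁ z - k₂ z, hk₁.sub hk₂, fun z hz hne => ?_⟩ hβ hβ' hex
    have h : coeff (chartAt ℂ x) ((φ₁ + (-1 : ℂ) • φ₂ : H0K2 x) : Form10 C) z
        = coeff (chartAt ℂ x) φ₁ z + (-1) * coeff (chartAt ℂ x) φ₂ z := rfl
    refine h.trans ?_
    rw [hE₁ z hz hne, hE₂ z hz hne]
    ring
  refine Subtype.ext (funext fun y => ?_)
  have key : ∀ A B : ℂ →L[ℂ] ℂ, A + (-1 : ℂ) • B = 0 → A = B := fun A B hAB => by
    ext
    have h : A 1 + (-1 : ℂ) * B 1 = 0 := congrArg (fun L : ℂ →L[ℂ] ℂ => L 1) hAB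
    linear_combination h
  exact key _ _ (congrFun h0 y)

end Uniqueness

/-! ### Naturality of φ_x and invariance of η. -/

section Invariance

variable {C : Type*} [TopologicalSpace C] [ChartedSpace ℂ C]

/-- The derivative at `x`, in the preferred charts at `x` and `τ x`, of an automorphism `τ`. -/
def derivInCharts (τ : Aut C) (x : C) : ℂ :=
  deriv (moveChart τ.symm (chartAt ℂ (τ x)) ∘ (chartAt ℂ x).symm) (chartAt ℂ x x)

theorem moveChart_symm_mem_source (τ : Aut C) (x : C) :
    x ∈ (moveChart τ.symm (chartAt ℂ (τ x))).source :=
  mem_chart_source ℂ (τ x)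

theorem moveChart_moveChart_symm (τ : Aut C) (e : OpenPartialHomeomorph C ℂ) :
    moveChart τ (moveChart τ.symm e) = e := by
  refine OpenPartialHomeomorph.ext _ _ (fun y => ?_) (fun z => ?_) ?_
  · exact congrArg e (τ.apply_symm_apply y)
  · exact τ.apply_symm_apply (e.symm z)
  · ext y
    exact iff_of_eq (congrArg (· ∈ e.source) (τ.apply_symm_apply y))

/-- The value at `x` of the differential `dz` of the preferred chart `z` at `x`. -/
def chartDifferential (x : C) : T x →L[ℂ] ℂ :=
  mfderiv 𝓘(ℂ) 𝓘(ℂ) (chartAt ℂ x) x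

variable [IsManifold 𝓘(ℂ) ω C]

theorem chartDifferential_mfderiv (τ : Aut C) (x : C) (u : T x) :
    chartDifferential (τ x) (mfderiv 𝓘(ℂ) 𝓘(ℂ) τ x u)
      = derivInCharts τ x * chartDifferential x u := by
  set e := chartAt ℂ x
  set f := moveChart τ.symm (chartAt ℂ (τ x))
  have he : e ∈ Charts C := IsManifold.chart_mem_maximalAtlas x
  have hc : chartAt ℂ (τ x) ∈ Charts C := IsManifold.chart_mem_maximalAtlas (τ x)
  have hf : f ∈ Charts C := moveChart_mem τ.symm hc
  have hx : x ∈ e.source := mem_chart_source ℂ x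
  have hd : ∀ {g : OpenPartialHomeomorph C ℂ} {y : C}, g ∈ Charts C → y ∈ g.source →
      HasMFDerivAt 𝓘(ℂ) 𝓘(ℂ) g y (mfderiv 𝓘(ℂ) 𝓘(ℂ) g y) := fun hg hy =>
    (((contMDiffOn_of_mem_maximalAtlas hg).contMDiffAt
      (OpenPartialHomeomorph.open_source _ |>.mem_nhds hy)).mdifferentiableAt (by simp)).hasMFDerivAt
  have h1 := (hd hc (mem_chart_source ℂ (τ x))).comp x (aut_hasMFDerivAt τ x)
  have hinv : e.symm (e x) = x := e.left_inv hx
  have ht := (analyticAt_transition hf he (e.map_source hx)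
    (by rw [hinv]; exact moveChart_symm_mem_source τ x)).differentiableAt
  have h2 : HasMFDerivAt 𝓘(ℂ) 𝓘(ℂ) (f ∘ e.symm) (e x) (fderiv ℂ (f ∘ e.symm) (e x)) :=
    ht.hasFDerivAt.hasMFDerivAt
  have h3 : chartAt ℂ (τ x) ∘ τ =ᶠ[𝓝 x] (f ∘ e.symm) ∘ e := by
    filter_upwards [e.open_source.mem_nhds hx] with y hy
    change f y = f (e.symm (e y))
    rw [e.left_inv hy]
  have h4 := hasMFDerivAt_unique h1 ((h2.comp x (hd he hx)).congr_of_eventuallyEq h3)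
  have h5 : chartDifferential (τ x) (mfderiv 𝓘(ℂ) 𝓘(ℂ) τ x u)
      = fderiv ℂ (f ∘ e.symm) (e x) (chartDifferential x u) :=
    congrArg (fun L : ℂ →L[ℂ] ℂ => L u) h4
  rw [h5]
  have key : ∀ (L : ℂ →L[ℂ] ℂ) (v : ℂ), L v = L 1 * v := fun L v => by
    conv_lhs => rw [← mul_one v, ← smul_eq_mul, map_smul, smul_eq_mul, mul_comm]
  exact key _ _

variable [T2Space C]

/-- The pull-back is normalised for the chart z' ∘ τ, where z' is the preferred chart at τ x;
passing to the preferred chart at x costs the factor `derivInCharts τ x`. -/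
theorem smul_pullbackV_mem (τ : Aut C) (x : C) {φ : H0K2 (τ x)} (hφ : φ ∈ etaLine (τ x))
    (hp : HasPrincipalPart (τ x) (φ : Form10 C)) :
    derivInCharts τ x • pullbackV τ x φ ∈ etaLine x ∧
      HasPrincipalPart x ((derivInCharts τ x • pullbackV τ x φ : H0K2 x) : Form10 C) := by
  refine ⟨(etaLine x).smul_mem _ (pullbackV_mem_etaLine τ x hφ), ?_⟩
  have hc : chartAt ℂ (τ x) ∈ Charts C := IsManifold.chart_mem_maximalAtlas (τ x)
  have he : chartAt ℂ x ∈ Charts C := IsManifold.chart_mem_maximalAtlas x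
  have hf := moveChart_mem τ.symm hc
  rw [hasPrincipalPart_iff (derivInCharts τ x • pullbackV τ x φ).2.2.1]
  rw [hasPrincipalPart_iff φ.2.2.1] at hp
  refine HasLocalPrincipalPart.change (φ := pullback τ (φ : Form10 C)) hf he
    (moveChart_symm_mem_source τ x) (mem_chart_source ℂ x) ?_
  rw [hasLocalPrincipalPart_pullback τ hf (moveChart_symm_mem_source τ x),
    moveChart_moveChart_symm]
  exact hp

/-- Ensures that `phi` takes its default value at x exactly when it does at τ x. -/
theorem exists_phi_iff (τ : Aut C) (x : C) :
    (∃ φ ∈ etaLine (τ x), HasPrincipalPart (τ x) (φ : Form10 C)) ↔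
      ∃ φ ∈ etaLine x, HasPrincipalPart x (φ : Form10 C) := by
  have h : ∀ (τ : Aut C) (x : C),
      (∃ φ ∈ etaLine (τ x), HasPrincipalPart (τ x) (φ : Form10 C)) →
        ∃ φ ∈ etaLine x, HasPrincipalPart x (φ : Form10 C) := by
    rintro τ x ⟨φ, hφ, hp⟩
    exact ⟨_, smul_pullbackV_mem τ x hφ hp⟩
  refine ⟨h τ x, fun hx => h τ.symm (τ x) ?_⟩
  rwa [τ.symm_apply_apply]

variable [CompactSpace C] [ConnectedSpace C]

/-- Naturality of `φ_x` under automorphisms. -/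
theorem smul_pullbackV_phi (τ : Aut C) (x : C) :
    derivInCharts τ x • pullbackV τ x (phi (τ x)) = phi x := by
  by_cases h : ∃ φ ∈ etaLine (τ x), HasPrincipalPart (τ x) (φ : Form10 C)
  · have h' := (exists_phi_iff τ x).1 h
    have h1 : phi (τ x) = h.choose := dif_pos h
    have h2 : phi x = h'.choose := dif_pos h'
    rw [h1, h2]
    obtain ⟨h3, h4⟩ := smul_pullbackV_mem τ x h.choose_spec.1 h.choose_spec.2
    exact eq_of_mem_etaLine_of_hasPrincipalPart h3 h'.choose_spec.1 h4 h'.choose_spec.2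
  · have h' := (exists_phi_iff τ x).not.1 h
    have h1 : phi (τ x) = 0 := dif_neg h
    have h2 : phi x = 0 := dif_neg h'
    rw [h1, h2, map_zero, smul_zero]

/-- For τ = σ⁻¹, the factor τ' from dz(dτ u) = τ' dz(u) is the one that turns τ^*φ_{τx} into φ_x. -/
theorem actE_eta (σ : Aut C) : actE σ (fun x : C => eta x) = fun x : C => eta x := by
  funext x
  refine LinearMap.ext fun u => ?_
  have h1 : actE σ (fun x : C => eta x) x u = pullbackV σ.symm x
      (chartDifferential (σ.symm x) (mfderiv 𝓘(ℂ) 𝓘(ℂ) σ.symm x u) • phi (σ.symm x)) := rfl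
  have h2 : eta x u = chartDifferential x u • phi x := rfl
  rw [h1, h2, map_smul, chartDifferential_mfderiv, mul_comm, mul_smul, smul_pullbackV_phi]

end Invariance

/-! ### Invariance of η̂. -/

section Square

variable {C : Type*} [TopologicalSpace C] [ChartedSpace ℂ C]

/-- An alternating 2-form on a plane is determined by one value on a basis; the other order of the
basis vectors only changes the sign. -/
theorem form20_ext {x y : C} {A B : TS (x, y) [⋀^Fin 2]→L[ℂ] ℂ}
    (h : ∀ (u : T x) (v : T y), A ![pair u 0, pair 0 v] = B ![pair u 0, pair 0 v]) : A = B := by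
  have key : ∀ A B : (ℂ × ℂ) [⋀^Fin 2]→L[ℂ] ℂ,
      (∀ u v : ℂ, A ![(u, 0), (0, v)] = B ![(u, 0), (0, v)]) → A = B := by
    intro A B h
    apply ContinuousAlternatingMap.toAlternatingMap_injective
    refine Module.Basis.ext_alternating (Module.Basis.finTwoProd ℂ) fun v hv => ?_
    have h10 : A ![(1, 0), (0, 1)] = B ![(1, 0), (0, 1)] := h 1 1
    have hswap : ∀ D : (ℂ × ℂ) [⋀^Fin 2]→L[ℂ] ℂ,
        D ![(0, 1), (1, 0)] = -D ![(1, 0), (0, 1)] := fun D => by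
      have := D.toAlternatingMap.map_swap ![(1, 0), (0, 1)] (i := 0) (j := 1) (by decide)
      rw [← ContinuousAlternatingMap.coe_toAlternatingMap, ← this]
      congr 1
      funext i
      fin_cases i <;> rfl
    have hv01 : v 0 ≠ v 1 := fun h => absurd (hv h) (by decide)
    have hvv : v = ![0, 1] ∨ v = ![1, 0] := by
      generalize ha : v 0 = a at *
      generalize hb : v 1 = b at *
      fin_cases a <;> fin_cases b
      · exact absurd rfl hv01
      · left; funext i; fin_cases i <;> simp [ha, hb]
      · right; funext i; fin_cases i <;> simp [ha, hb]
      · exact absurd rfl hv01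
    rcases hvv with rfl | rfl
    · have hb : (fun i => Module.Basis.finTwoProd ℂ ((![0, 1] : Fin 2 → Fin 2) i))
          = ![(1, 0), (0, 1)] := by
        funext i
        fin_cases i <;> simp
      rw [hb]
      exact h10
    · have hb : (fun i => Module.Basis.finTwoProd ℂ ((![1, 0] : Fin 2 → Fin 2) i))
          = ![(0, 1), (1, 0)] := by
        funext i
        fin_cases i <;> simp
      rw [hb]
      exact (hswap A).trans ((congrArg Neg.neg h10).trans (hswap B).symm)
  exact key A B h

/-- A section of `K_S(2Δ)` is determined by the section of `E` it corresponds to. -/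
theorem Corresponds.unique {α : (x : C) → E x} {β₁ β₂ : H0L C} (h₁ : Corresponds α β₁)
    (h₂ : Corresponds α β₂) : β₁ = β₂ := by
  refine Subtype.ext (funext fun p => ?_)
  obtain ⟨x, y⟩ := p
  by_cases hxy : x = y
  · subst hxy
    rw [β₁.2.1 x, β₂.2.1 x]
  · exact form20_ext fun u v => (h₁ x y hxy u v).symm.trans (h₂ x y hxy u v)

theorem mfderiv_prodMap_aut_pair (τ : Aut C) (x y : C) (u : T x) (v : T y) :
    mfderiv (𝓘(ℂ).prod 𝓘(ℂ)) (𝓘(ℂ).prod 𝓘(ℂ)) (Prod.map τ τ) (x, y) (pair u v)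
      = pair (mfderiv 𝓘(ℂ) 𝓘(ℂ) τ x u) (mfderiv 𝓘(ℂ) 𝓘(ℂ) τ y v) := by
  have h : mfderiv (𝓘(ℂ).prod 𝓘(ℂ)) (𝓘(ℂ).prod 𝓘(ℂ)) (Prod.map τ τ) (x, y)
      = (mfderiv 𝓘(ℂ) 𝓘(ℂ) τ x).prodMap (mfderiv 𝓘(ℂ) 𝓘(ℂ) τ y) :=
    (HasMFDerivAt.prodMap (p := (x, y)) (aut_hasMFDerivAt τ x) (aut_hasMFDerivAt τ y)).mfderiv
  rw [h]
  rfl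

variable [IsManifold 𝓘(ℂ) ω C]

/-- The correspondence between sections of `E` and of `K_S(2Δ)` is equivariant. -/
theorem Corresponds.act {α : (x : C) → E x} {β : H0L C} (h : Corresponds α β) (σ : Aut C) :
    Corresponds (actE σ α) (actL σ β) := by
  intro x y hxy u v
  have h1 := h (σ.symm x) (σ.symm y) (fun hs => hxy (σ.symm.injective hs))
    (mfderiv 𝓘(ℂ) 𝓘(ℂ) σ.symm x u) (mfderiv 𝓘(ℂ) 𝓘(ℂ) σ.symm y v)
  refine h1.trans ?_
  change _ = ((β : Form20 C) (σ.symm x, σ.symm y)) _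
  congr 1
  funext i
  fin_cases i
  · exact ((mfderiv_prodMap_aut_pair σ.symm x y u 0).trans
      (congrArg (pair _) (map_zero _))).symm
  · exact ((mfderiv_prodMap_aut_pair σ.symm x y 0 v).trans
      (congrArg (fun w => pair w _) (map_zero _))).symm

/-- σ · η̂ corresponds to σ · η = η, so it is η̂ by uniqueness; in the default case linearity fixes
0. -/
theorem actL_etaHat [T2Space C] [CompactSpace C] [ConnectedSpace C] (σ : Aut C) :
    actL σ (etaHat C) = etaHat C := by
  by_cases h : ∃ β : H0L C, Corresponds (fun x : C => eta x) β
  · have h1 : etaHat C = h.choose := dif_pos h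
    rw [h1]
    have h2 := h.choose_spec.act σ
    rw [actE_eta] at h2
    exact h2.unique h.choose_spec
  · have h1 : etaHat C = 0 := dif_neg h
    rw [h1, map_zero]

end Square

end RiemannSurface
end

theorem mainTheorem10 {C : Type*} [TopologicalSpace C] [T2Space C] [CompactSpace C]
    [ConnectedSpace C] [ChartedSpace ℂ C] [IsManifold 𝓘(ℂ) ω C]
    (hg : 4 ≤ RiemannSurface.genus C) (σ : RiemannSurface.Aut C) :
    RiemannSurface.actE σ (fun x : C => RiemannSurface.eta x)
        = (fun x : C => RiemannSurface.eta x) ∧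
      RiemannSurface.actL σ (RiemannSurface.etaHat C) = RiemannSurface.etaHat C :=
  ⟨RiemannSurface.actE_eta σ, RiemannSurface.actL_etaHat σ⟩
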